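/- Let $k\ge 2$ be an integer and let $H_k$ be the following graph. Take four disjoint triangles $A_1,A_2,B_1,B_2$, each with nodes labelled $1,2,3$; join node $1$ of $A_1$ to node $1$ of $A_2$ and node $1$ of $B_1$ to node $1$ of $B_2$ by an edge; and for $i=1,2$ join node $2$ of $A_i$ to node $2$ of $B_i$ by $k$ internally disjoint paths of length $3$. ($H_k$-detection, respectively induced $H_k$-detection, asks whether an input graph $G$ contains $H_k$ as a subgraph, respectively as an induced subgraph.) Then the following hold. 1. $H_k$ is a (two-terminal) series-parallel graph and has treewidth exactly $2$. 2. There are functions $m,C:\mathbb N\to\mathbb N$ with $m(n)=\Theta(n^2)$ and $C(n)=\Theta(n^{1/k})$ and $n$-node graphs $G(n,x_0,x_1)$, for $n \in \mathbb N$ and $x_0,x_1\in\{0,1\}^{m(n)}$, such that for all sufficiently large $n$: for all $x_0,x_1$, the graph $G(n,x_0,x_1)$ contains no copy of $H_k$ if and only if it contains no induced copy of $H_k$, if and only if $\mathsf{DISJ}_{m(n)}(x_0,x_1)=1$ (that is, there is no $i$ with $x_0(i)=x_1(i)=1$); and $G(n,x_0,x_1)=(V_0\cup V_1,\,E_0\cup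 E_1\cup S)$, where $V_0,V_1$ are disjoint with $|V_0\cup V_1|=n$, the edges $E_i$ lie inside $V_i$ and depend only on $n$ and $x_i$, and $S$ consists of exactly $C(n)$ edges between $V_0$ and $V_1$; here $V_0,V_1,S$ depend only on $n$. 3. There are $c>0$ and $n_0$, depending only on $k$, such that for all $n\ge n_0$ and all $b,T \in \mathbb N$: if some CONGEST algorithm with messages of at most $b$ bits per edge, direction and round solves $H_k$-detection, or induced $H_k$-detection, in $T$ rounds on all $n$-node graphs, then $T\cdot b\ge c\,n^{2-1/k}$. This holds for deterministic algorithms and for randomized algorithms (even with shared randomness) that are correct with probability at least $2/3$ on every input graph. An algorithm answers yes if at least one node reports yes; nodes have unrestricted local computation and know $n$, their identifiers from $\{1, \dots, n\}$, and the identifiers of their neighbours. 4. In particular, for each $\beta>0$ there are $c>0$ and $n_0$, depending only on $k$ and $\beta$, such that for all $n\ge n_0$ every such deterministic or randomized CONGEST algorithm with bandwidth at most $\beta\log n$ needs at least $c\,n^{2-1/k}/\log n$ rounds. That is, both $H_k$-detection and induced $H_k$-detection need $\Omega(n^{2-1/k}/\log n)$ rounds. -/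

import Mathlib

open Filter Asymptotics MeasureTheory
open scoped ENNReal

namespace SimpleGraph

variable {V : Type*}

/-- A tree decomposition of `G` with bags indexed by the nodes of a tree on `ι`. -/
structure TreeDecomposition (G : SimpleGraph V) (ι : Type) where
  tree : SimpleGraph ι
  isTree : tree.IsTree
  bag : ι → Finset V
  vertex_mem : ∀ v : V, ∃ i, v ∈ bag i
  edge_mem : ∀ u v : V, G.Adj u v → ∃ i, u ∈ bag i ∧ v ∈ bag i
  path_mem : ∀ (i l : ι) (p : tree.Walk i l), p.IsPath → ∀ j ∈ p.support,
    ∀ v, v ∈ bag i → v ∈ bag l → v ∈ bag j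

/-- The width of a tree decomposition: the maximum bag size minus one. -/
def TreeDecomposition.width {G : SimpleGraph V} {ι : Type} [Fintype ι]
    (D : G.TreeDecomposition ι) : ℕ :=
  (Finset.univ.sup fun i => (D.bag i).card) - 1

/-- The treewidth of a (finite, nonempty) graph: the minimum width of a tree decomposition. -/
noncomputable def treewidth (G : SimpleGraph V) : ℕ :=
  sInf {w | ∃ (ι : Type) (_ : Fintype ι) (D : G.TreeDecomposition ι), D.width = w}

/-- `IsTwoTerminalSP S s t`: the subgraph `S` of `G` is a two-terminal series-parallel graph with
terminals `s` and `t`, i.e. it is obtained from single edges by series and parallel compositions. -/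
inductive IsTwoTerminalSP {G : SimpleGraph V} : G.Subgraph → V → V → Prop
  | edge {s t : V} (h : G.Adj s t) : IsTwoTerminalSP (G.subgraphOfAdj h) s t
  | series {S₁ S₂ : G.Subgraph} {s m t : V} :
      IsTwoTerminalSP S₁ s m → IsTwoTerminalSP S₂ m t → S₁.verts ∩ S₂.verts = {m} →
      IsTwoTerminalSP (S₁ ⊔ S₂) s t
  | parallel {S₁ S₂ : G.Subgraph} {s t : V} :
      IsTwoTerminalSP S₁ s t → IsTwoTerminalSP S₂ s t → S₁.verts ∩ S₂.verts = {s, t} →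
      IsTwoTerminalSP (S₁ ⊔ S₂) s t

/-- A graph is series-parallel if it is two-terminal series-parallel for some two terminals. -/
def IsSeriesParallel (G : SimpleGraph V) : Prop :=
  ∃ s t : V, IsTwoTerminalSP (⊤ : G.Subgraph) s t

end SimpleGraph

/-- Vertices of the pattern. `Sum.inl (s, i, l)` is the node with label `l` (the labels `0, 1, 2`
stand for the labels 1, 2, 3) of triangle number `i` on side `s` (side `0` is `A`, side `1` is `B`).
`Sum.inr (s, i, p)` is the inner node next to side `s` of the `p`-th path of length three
between the two triangles number `i`. -/
abbrev PatternVertex (k : ℕ) : Type :=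
  (Fin 2 × Fin 2 × Fin 3) ⊕ (Fin 2 × Fin 2 × Fin k)

/-- The pattern `H_k`: four triangles `A₁, A₂, B₁, B₂`; an edge between the nodes 1 of `A₁` and `A₂`
and one between the nodes 1 of `B₁` and `B₂`; and, for `i = 1, 2`, `k` internally disjoint paths of
length three between the node 2 of `A_i` and the node 2 of `B_i`. -/
def patternGraph (k : ℕ) : SimpleGraph (PatternVertex k) where
  Adj
    | .inl (s, i, l), .inl (s', i', l') =>
        s = s' ∧ ((i = i' ∧ l ≠ l') ∨ (i ≠ i' ∧ l = 0 ∧ l' = 0))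
    | .inl (s, i, l), .inr (s', i', _) => s = s' ∧ i = i' ∧ l = 1
    | .inr (s, i, _), .inl (s', i', l') => s = s' ∧ i = i' ∧ l' = 1
    | .inr (s, i, p), .inr (s', i', p') => s ≠ s' ∧ i = i' ∧ p = p'
  symm := ⟨by
    rintro (⟨s, i, l⟩ | ⟨s, i, p⟩) (⟨s', i', l'⟩ | ⟨s', i', p'⟩) h <;> simp only at h ⊢ <;> grind⟩
  loopless := ⟨by
    rintro (⟨s, i, l⟩ | ⟨s, i, p⟩) h <;> simp only at h <;> grind⟩

/-! ### Families of lower bound graphs -/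

/-- Set disjointness on `m` bits: the value is `false` iff the two inputs share a one. -/
def disj (m : ℕ) (x₀ x₁ : Fin m → Bool) : Bool :=
  decide (¬ ∃ i, x₀ i = true ∧ x₁ i = true)

/-- The graphs `G n x₀ x₁` on `n` nodes form a family of lower bound graphs for the graph predicate
`P` with respect to the functions `f n` on two `m n`-bit inputs, with cut size `C n`: for all large
`n`, `G n x₀ x₁` satisfies `P` iff `f n x₀ x₁ = 1`, and `G n x₀ x₁` is the union of a graph
on `V₀` that depends on `x₀` only, a graph on `V₁` that depends on `x₁` only, and a fixed set of
`C n` edges between `V₀` and `V₁`. -/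
def IsLowerBoundFamily (P : ∀ n : ℕ, SimpleGraph (Fin n) → Prop) (m C : ℕ → ℕ)
    (f : ∀ n : ℕ, (Fin (m n) → Bool) → (Fin (m n) → Bool) → Bool)
    (G : ∀ n : ℕ, (Fin (m n) → Bool) → (Fin (m n) → Bool) → SimpleGraph (Fin n)) : Prop :=
  ∃ n₀ : ℕ, ∀ n ≥ n₀,
    (∀ x₀ x₁, P n (G n x₀ x₁) ↔ f n x₀ x₁ = true) ∧
    ∃ (V₀ V₁ : Set (Fin n)) (E₀ E₁ : (Fin (m n) → Bool) → SimpleGraph (Fin n))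
      (S : SimpleGraph (Fin n)),
      Disjoint V₀ V₁ ∧ V₀ ∪ V₁ = Set.univ ∧
      (∀ x u v, (E₀ x).Adj u v → u ∈ V₀ ∧ v ∈ V₀) ∧
      (∀ x u v, (E₁ x).Adj u v → u ∈ V₁ ∧ v ∈ V₁) ∧
      (∀ u v, S.Adj u v → (u ∈ V₀ ∧ v ∈ V₁) ∨ (u ∈ V₁ ∧ v ∈ V₀)) ∧
      S.edgeSet.ncard = C n ∧
      ∀ x₀ x₁, G n x₀ x₁ = E₀ x₀ ⊔ E₁ x₁ ⊔ S

/-! ### The CONGEST model -/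

/-- A message of at most `B` bits. -/
abbrev Message (B : ℕ) : Type := {w : List Bool // w.length ≤ B}

/-- A deterministic algorithm in the CONGEST model with bandwidth `B` on `n`-node networks with node
identifiers `Fin n`. Initially a node knows its identifier and those of its neighbours (and `n` and
`B`). In each synchronous round it sends one message of at most `B` bits to each of its neighbours,
receives their messages, and updates its state. Local computation is unrestricted. -/
structure CongestAlgorithm (n B : ℕ) where
  State : Type
  init : Fin n → Set (Fin n) → State
  /-- `send q u` is what a node in state `q` sends to its neighbour `u`. -/
  send : State → Fin n → Message B
  /-- The received messages are indexed by the sender, `none` for a non-neighbour. -/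
  receive : State → (Fin n → Option (Message B)) → State
  output : State → Bool

namespace CongestAlgorithm

variable {n B : ℕ}

open Classical in
/-- The state of each node after `t` rounds on the network `G`. -/
noncomputable def run (A : CongestAlgorithm n B) (G : SimpleGraph (Fin n)) :
    ℕ → Fin n → A.State
  | 0, v => A.init v (G.neighborSet v)
  | t + 1, v => A.receive (A.run G t v) fun u =>
      if G.Adj u v then some (A.send (A.run G t u) v) else none

/-- After `T` rounds, some node reports that the network is a yes-instance. -/
def Accepts (A : CongestAlgorithm n B) (T : ℕ) (G : SimpleGraph (Fin n)) : Prop :=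
  ∃ v, A.output (A.run G T v) = true

end CongestAlgorithm

/-- Some deterministic CONGEST algorithm with bandwidth `B` decides `P` in `T` rounds on all
`n`-node networks: some node reports a yes-instance iff the network satisfies `P`. -/
def DeterministicallySolvable {n : ℕ} (P : SimpleGraph (Fin n) → Prop) (B T : ℕ) : Prop :=
  ∃ A : CongestAlgorithm n B, ∀ G : SimpleGraph (Fin n), A.Accepts T G ↔ P G

/-- Some randomized CONGEST algorithm with bandwidth `B` decides `P` in `T` rounds with probability
at least `2/3` on every `n`-node network. A point of `Ω` holds all random bits of all nodes; the
nodes may share them (independent private bits are the case where node `v` uses only its own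
coordinate of a product space). -/
def RandomizedSolvable {n : ℕ} (P : SimpleGraph (Fin n) → Prop) (B T : ℕ) : Prop :=
  ∃ (Ω : Type) (_ : MeasurableSpace Ω) (μ : Measure Ω) (_ : IsProbabilityMeasure μ)
    (A : Ω → CongestAlgorithm n B), ∀ G : SimpleGraph (Fin n),
      MeasurableSet {ω | (A ω).Accepts T G ↔ P G} ∧
      (2 / 3 : ℝ≥0∞) ≤ μ {ω | (A ω).Accepts T G ↔ P G}

/-- `H`-detection on `n`-node networks: does `G` contain a copy of `H`? -/
def HasCopy {W : Type*} (H : SimpleGraph W) (n : ℕ) (G : SimpleGraph (Fin n)) : Prop :=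
  H.IsContained G

/-- Induced `H`-detection on `n`-node networks: does `G` contain an induced copy of `H`? -/
def HasInducedCopy {W : Type*} (H : SimpleGraph W) (n : ℕ) (G : SimpleGraph (Fin n)) : Prop :=
  H.IsIndContained G

/-!
The four triangles of the pattern, with the bridges and the bundles of paths between them, lie on a
cycle. Hence the pattern is a parallel composition of one bridge with a series composition of the
rest, and triangulating the cycle gives a tree decomposition of width two.

In the lower bound graphs each of two sides has two groups of `s ^ k` triangles. A triangle is named
by a word of length `k` over an alphabet of `s` letters, and its node 2 is joined to the nodes for
the letters of its word, one for each position. Only the `4 * k * s` letter nodes meet the other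
side, where each is matched with its counterpart. The input of a side is a relation between the
words of its two groups: it determines the edges between the nodes 1 of its triangles. The `k` paths
between two triangles of a copy of the pattern have to use all `k` positions, so the two triangles
have the same word, and a copy of the pattern is a pair of words on which both inputs are true. With
`s` of order `n ^ (1 / k)` the inputs have order `n ^ 2` bits and the cut order `n ^ (1 / k)` edges.

Two parties that simulate an algorithm exchange only the messages over the cut, so a fast algorithm
would give a short protocol for set disjointness. The linear lower bound for randomized disjointness
compares disjoint inputs with the ones in which a common bit is planted. By cut and paste, the
Hellinger distance of the transcripts for a disjoint and for an intersecting pair is bounded by the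
distances caused by a change of a single bit of a single input; Chang's level-one inequality bounds
the sum of the latter over all positions by the length of the transcript.
-/

/-! ### Randomized communication complexity of set disjointness -/

section Disjointness

open Finset

section LevelOne

variable {ι : Type*} [Fintype ι]

/-- The sign `±1` of a bit, i.e. the value of a first-level character of the Boolean cube. -/
noncomputable def bitSign (b : Bool) : ℝ := if b then 1 else -1

theorem sum_exp_sum_mul_bitSign_le [DecidableEq ι] (b : ι → ℝ) :
    ∑ z : ι → Bool, Real.exp (∑ j, b j * bitSign (z j)) ≤
      2 ^ Fintype.card ι * Real.exp ((∑ j, b j ^ 2) / 2) := by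
  have hcosh (j : ι) : ∑ a : Bool, Real.exp (b j * bitSign a) = 2 * Real.cosh (b j) := by
    simp [bitSign, Real.cosh_eq, mul_div_cancel₀]
  calc ∑ z : ι → Bool, Real.exp (∑ j, b j * bitSign (z j))
      = ∏ j, 2 * Real.cosh (b j) := by
        simp only [Real.exp_sum, ← hcosh, prod_univ_sum, Fintype.piFinset_univ]
    _ ≤ ∏ j, 2 * Real.exp (b j ^ 2 / 2) :=
        prod_le_prod (fun j _ => by positivity) fun j _ => by
          gcongr; exact Real.cosh_le_exp_half_sq _
    _ = 2 ^ Fintype.card ι * Real.exp ((∑ j, b j ^ 2) / 2) := by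
        rw [prod_mul_distrib, prod_const, card_univ, sum_div, Real.exp_sum]

theorem mean_sum_mul_bitSign_le {S : Finset (ι → Bool)} (hS : S.Nonempty) (b : ι → ℝ) :
    (∑ z ∈ S, ∑ j, b j * bitSign (z j)) / #S ≤
      Real.log (2 ^ Fintype.card ι / #S) + (∑ j, b j ^ 2) / 2 := by
  classical
  have hcard : (0 : ℝ) < #S := by exact_mod_cast hS.card_pos
  have jensen : Real.exp (∑ z ∈ S, (#S : ℝ)⁻¹ • ∑ j, b j * bitSign (z j)) ≤
      ∑ z ∈ S, (#S : ℝ)⁻¹ • Real.exp (∑ j, b j * bitSign (z j)) :=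
    convexOn_exp.map_sum_le (fun _ _ => by positivity)
      (by rw [sum_const, nsmul_eq_mul, mul_inv_cancel₀ hcard.ne']) fun _ _ => Set.mem_univ _
  rw [← Real.exp_le_exp, Real.exp_add, Real.exp_log (by positivity)]
  simp only [smul_eq_mul, inv_mul_eq_div, ← sum_div] at jensen
  calc _ ≤ (∑ z ∈ S, Real.exp (∑ j, b j * bitSign (z j))) / #S := jensen
    _ ≤ (∑ z : ι → Bool, Real.exp (∑ j, b j * bitSign (z j))) / (#S : ℝ) := by
        gcongr
        exact subset_univ S
    _ ≤ 2 ^ Fintype.card ι * Real.exp ((∑ j, b j ^ 2) / 2) / #S := by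
        gcongr; exact sum_exp_sum_mul_bitSign_le b
    _ = _ := by ring

/-- Chang's level-one inequality: apply `mean_sum_mul_bitSign_le` to the vector of first-level
Fourier coefficients itself. -/
theorem sum_sq_sum_bitSign_le (S : Finset (ι → Bool)) :
    ∑ j, (∑ z ∈ S, bitSign (z j)) ^ 2 ≤
      2 * (#S : ℝ) ^ 2 * Real.log (2 ^ Fintype.card ι / #S) := by
  rcases S.eq_empty_or_nonempty with rfl | hS
  · simp
  have hcard : (0 : ℝ) < #S := by exact_mod_cast hS.card_pos
  obtain ⟨b, hsum⟩ : ∃ b : ι → ℝ, ∀ j, ∑ z ∈ S, bitSign (z j) = #S * b j :=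
    ⟨fun j => (∑ z ∈ S, bitSign (z j)) / #S, fun j => (mul_div_cancel₀ _ hcard.ne').symm⟩
  have hself : (∑ z ∈ S, ∑ j, b j * bitSign (z j)) / #S = ∑ j, b j ^ 2 := by
    rw [sum_comm, sum_div]
    refine sum_congr rfl fun j _ => ?_
    rw [← mul_sum, hsum, mul_left_comm, mul_div_cancel_left₀ _ hcard.ne', sq]
  have hmean := mean_sum_mul_bitSign_le hS b
  rw [hself] at hmean
  calc ∑ j, (∑ z ∈ S, bitSign (z j)) ^ 2 = (#S : ℝ) ^ 2 * ∑ j, b j ^ 2 := by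
        simp only [hsum, mul_pow, mul_sum]
    _ ≤ (#S : ℝ) ^ 2 * (2 * Real.log (2 ^ Fintype.card ι / #S)) := by
        gcongr; linarith
    _ = _ := by ring

end LevelOne

section Hellinger

variable {τ : Type*} [Fintype τ]

theorem sum_mul_log_sum_div_le {s : τ → ℝ} (hs : ∀ t, 0 ≤ s t) :
    ∑ t, s t * Real.log ((∑ u, s u) / s t) ≤ (∑ t, s t) * Real.log (Fintype.card τ) := by
  set N := ∑ t, s t
  set M : ℝ := (Fintype.card τ : ℝ)
  have hterm (t : τ) : s t * Real.log (N / s t) ≤ N / M - s t + s t * Real.log M := by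
    have hM : 0 < M := Nat.cast_pos.mpr (Fintype.card_pos_iff.mpr ⟨t⟩)
    have hN : 0 ≤ N := sum_nonneg fun u _ => hs u
    rcases (hs t).eq_or_lt' with h | h
    · rw [h]; simpa using by positivity
    have hN' : 0 < N := h.trans_le (single_le_sum (fun u _ => hs u) (mem_univ t))
    calc s t * Real.log (N / s t) = s t * (Real.log (N / (s t * M)) + Real.log M) := by
          rw [← Real.log_mul (by positivity) hM.ne']; congr 2; field_simp
      _ ≤ s t * (N / (s t * M) - 1 + Real.log M) := by
          gcongr; exact Real.log_le_sub_one_of_pos (by positivity)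
      _ = _ := by field_simp
  refine (sum_le_sum fun t _ => hterm t).trans ?_
  rcases isEmpty_or_nonempty τ
  · simp [N]
  have hM : M ≠ 0 := Nat.cast_ne_zero.mpr Fintype.card_ne_zero
  rw [sum_add_distrib, sum_sub_distrib, ← sum_mul, sum_const, card_univ, nsmul_eq_mul,
    mul_div_cancel₀ _ hM, sub_self, zero_add]

/-- The squared Hellinger distance of two functions, without a normalizing factor. -/
noncomputable def hellingerSq (p q : τ → ℝ) : ℝ := ∑ t, (√(p t) - √(q t)) ^ 2

theorem hellingerSq_eq_sub {p q : τ → ℝ} (hp : ∀ t, 0 ≤ p t) (hq : ∀ t, 0 ≤ q t) :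
    hellingerSq p q = ∑ t, p t + ∑ t, q t - 2 * ∑ t, √(p t * q t) := by
  rw [hellingerSq, mul_sum, ← sum_add_distrib, ← sum_sub_distrib]
  refine sum_congr rfl fun t _ => ?_
  rw [Real.sqrt_mul (hp t), sub_sq, Real.sq_sqrt (hp t), Real.sq_sqrt (hq t)]
  ring

theorem hellingerSq_le_two_mul_add (p q r : τ → ℝ) :
    hellingerSq p q ≤ 2 * (hellingerSq p r + hellingerSq q r) := by
  simp only [hellingerSq]
  rw [← sum_add_distrib, mul_sum]
  refine sum_le_sum fun t _ => ?_
  nlinarith [sq_nonneg (√(p t) + √(q t) - 2 * √(r t))]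

theorem sub_eq_sqrt_sub_sqrt_mul {a b : ℝ} (ha : 0 ≤ a) (hb : 0 ≤ b) :
    a - b = (√a - √b) * (√a + √b) := by
  rw [mul_comm, ← sq_sub_sq, Real.sq_sqrt ha, Real.sq_sqrt hb]

theorem sub_le_mul_sq_sqrt_sub_sqrt_add {a b c : ℝ} (ha : 0 ≤ a) (hb : 0 ≤ b) (hc : 0 < c) :
    a - b ≤ c / 2 * (√a - √b) ^ 2 + (a + b) / c := by
  have hamgm : 2 * c * ((√a - √b) * (√a + √b)) ≤ c ^ 2 * (√a - √b) ^ 2 + (√a + √b) ^ 2 := by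
    nlinarith [sq_nonneg (c * (√a - √b) - (√a + √b))]
  have hplus : (√a + √b) ^ 2 ≤ 2 * (a + b) := by
    nlinarith [Real.sq_sqrt ha, Real.sq_sqrt hb, sq_nonneg (√a - √b)]
  rw [← sub_nonneg, show c / 2 * (√a - √b) ^ 2 + (a + b) / c - (a - b) =
    (c ^ 2 * (√a - √b) ^ 2 + 2 * (a + b) - 2 * c * (a - b)) / (2 * c) by field_simp]
  exact div_nonneg (by rw [sub_eq_sqrt_sub_sqrt_mul ha hb]; linarith) (by positivity)

theorem sum_sub_sum_le_hellingerSq {p q : τ → ℝ} (hp : ∀ t, 0 ≤ p t) (hq : ∀ t, 0 ≤ q t)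
    {c : ℝ} (hc : 0 < c) (s : Finset τ) :
    ∑ t ∈ s, p t - ∑ t ∈ s, q t ≤ c / 2 * hellingerSq p q + (∑ t, p t + ∑ t, q t) / c := by
  rw [← sum_sub_distrib, hellingerSq, mul_sum, ← sum_add_distrib, sum_div, ← sum_add_distrib]
  calc ∑ t ∈ s, (p t - q t)
      ≤ ∑ t ∈ s, (c / 2 * (√(p t) - √(q t)) ^ 2 + (p t + q t) / c) :=
        sum_le_sum fun t _ => sub_le_mul_sq_sqrt_sub_sqrt_add (hp t) (hq t) hc
    _ ≤ _ := sum_le_sum_of_subset_of_nonneg (subset_univ s) fun t _ _ =>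
        add_nonneg (by positivity) (div_nonneg (add_nonneg (hp t) (hq t)) hc.le)

theorem sq_sqrt_sub_sqrt_le_div {a b : ℝ} (ha : 0 ≤ a) (hb : 0 ≤ b) :
    (√a - √b) ^ 2 ≤ (a - b) ^ 2 / (a + b) := by
  rcases (add_nonneg ha hb).eq_or_lt' with h | h
  · rw [show a = 0 by linarith, show b = 0 by linarith]; simp
  rw [le_div_iff₀ h, sub_eq_sqrt_sub_sqrt_mul ha hb, mul_pow]
  gcongr
  nlinarith [Real.sq_sqrt ha, Real.sq_sqrt hb, mul_nonneg (Real.sqrt_nonneg a) (Real.sqrt_nonneg b)]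

end Hellinger

section Influence

variable {ι τ : Type*} [Fintype ι] [DecidableEq τ]

/-- The number of points where `f` takes the value `t`: the unnormalized distribution of `f` at a
uniformly random point, as a real number. -/
noncomputable def fiberCard {α : Type*} [Fintype α] (f : α → τ) (t : τ) : ℝ :=
  #{z | f z = t}

theorem fiberCard_nonneg {α : Type*} [Fintype α] (f : α → τ) (t : τ) : 0 ≤ fiberCard f t :=
  Nat.cast_nonneg _

theorem sum_fiberCard_eq_card_filter {α : Type*} [Fintype α] (f : α → τ) (s : Finset τ) :
    ∑ t ∈ s, fiberCard f t = #{z | f z ∈ s} := by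
  simp only [fiberCard]
  exact_mod_cast sum_card_fiberwise_eq_card_filter univ s f

theorem sum_fiberCard {α : Type*} [Fintype α] [Fintype τ] (f : α → τ) :
    ∑ t, fiberCard f t = Fintype.card α := by
  simp [sum_fiberCard_eq_card_filter]

variable [DecidableEq ι]

theorem sum_comp_update (g : (ι → Bool) → ℝ) (j : ι) (b : Bool) :
    ∑ z, g (Function.update z j b) = 2 * ∑ z with z j = b, g z := by
  have hinvol : Function.Involutive fun z : ι → Bool => Function.update z j (!z j) := by
    intro z; simp
  have hflip : ∑ z with z j ≠ b, g (Function.update z j b) = ∑ z with z j = b, g z := by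
    refine sum_equiv (hinvol.toPerm _) (fun z => ?_) fun z hz => ?_
    · cases b <;> simp
    · have hzj : (!z j) = b := Bool.not_eq.mpr (mem_filter.mp hz).2
      rw [← hzj]; rfl
  have hfix : ∑ z with z j = b, g (Function.update z j b) = ∑ z with z j = b, g z := by
    refine sum_congr rfl fun z hz => ?_
    rw [← (mem_filter.mp hz).2, Function.update_eq_self]
  rw [← sum_filter_add_sum_filter_not univ (fun z : ι → Bool => z j = b), hfix, hflip, two_mul]

theorem fiberCard_comp_update (f : (ι → Bool) → τ) (j : ι) (b : Bool) (t : τ) :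
    fiberCard (fun z => f (Function.update z j b)) t =
      2 * ∑ z with f z = t, if z j = b then 1 else 0 := by
  rw [fiberCard, natCast_card_filter, sum_comp_update (fun z => if f z = t then (1 : ℝ) else 0),
    sum_filter, sum_filter]
  exact congrArg _ (sum_congr rfl fun z _ => by split_ifs <;> rfl)

theorem sum_sq_sqrt_fiberCard_comp_update_sub_le (f : (ι → Bool) → τ) (t : τ) :
    ∑ j, (√(fiberCard (fun z => f (Function.update z j true)) t) -
        √(fiberCard (fun z => f (Function.update z j false)) t)) ^ 2 ≤
      4 * (fiberCard f t * Real.log (2 ^ Fintype.card ι / fiberCard f t)) := by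
  have hadd (j : ι) : fiberCard (fun z => f (Function.update z j true)) t +
      fiberCard (fun z => f (Function.update z j false)) t = 2 * fiberCard f t := by
    rw [fiberCard_comp_update, fiberCard_comp_update, ← mul_add, ← sum_add_distrib, fiberCard,
      card_eq_sum_ones, Nat.cast_sum]
    exact congrArg _ (sum_congr rfl fun z _ => by cases z j <;> simp)
  have hsub (j : ι) : fiberCard (fun z => f (Function.update z j true)) t -
      fiberCard (fun z => f (Function.update z j false)) t =
        2 * ∑ z with f z = t, bitSign (z j) := by
    rw [fiberCard_comp_update, fiberCard_comp_update, ← mul_sub, ← sum_sub_distrib]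
    exact congrArg _ (sum_congr rfl fun z _ => by cases z j <;> simp [bitSign])
  calc _ ≤ ∑ j, (2 * ∑ z with f z = t, bitSign (z j)) ^ 2 / (2 * fiberCard f t) :=
        sum_le_sum fun j _ => by
          rw [← hadd j, ← hsub j]
          exact sq_sqrt_sub_sqrt_le_div (fiberCard_nonneg _ _) (fiberCard_nonneg _ _)
    _ = (∑ j, (∑ z with f z = t, bitSign (z j)) ^ 2) * (2 / fiberCard f t) := by
        rw [sum_mul]; exact sum_congr rfl fun j _ => by ring
    _ ≤ 2 * fiberCard f t ^ 2 * Real.log (2 ^ Fintype.card ι / fiberCard f t) *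
          (2 / fiberCard f t) :=
        mul_le_mul_of_nonneg_right (sum_sq_sum_bitSign_le _)
          (div_nonneg zero_le_two (fiberCard_nonneg f t))
    _ = _ := by
        rcases eq_or_ne (fiberCard f t) 0 with h | h
        · simp [h]
        · field_simp; ring

theorem sum_hellingerSq_comp_update_le [Fintype τ] (f : (ι → Bool) → τ) :
    ∑ j, hellingerSq (fiberCard fun z => f (Function.update z j true))
        (fiberCard fun z => f (Function.update z j false)) ≤
      4 * (2 ^ Fintype.card ι * Real.log (Fintype.card τ)) := by
  have htotal : ∑ t, fiberCard f t = 2 ^ Fintype.card ι := by simp [sum_fiberCard]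
  simp only [hellingerSq]
  rw [sum_comm, ← htotal]
  refine (sum_le_sum fun t _ => sum_sq_sqrt_fiberCard_comp_update_sub_le f t).trans ?_
  rw [← mul_sum, ← htotal]
  gcongr
  exact sum_mul_log_sum_div_le fun t => fiberCard_nonneg f t

end Influence

section Rectangles

variable {X Y ι σ : Type*}

/-- The transcript map `F` of a two-party protocol partitions the pairs of inputs into combinatorial
rectangles. -/
def IsRectangular (F : X → Y → σ) : Prop :=
  ∀ x y x' y', F x y = F x' y' → F x y' = F x y

theorem IsRectangular.eq_iff {F : X → Y → σ} (hF : IsRectangular F) (x : X) (y : Y)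
    (t : σ) : F x y = t ↔ (∃ y', F x y' = t) ∧ ∃ x', F x' y = t := by
  refine ⟨fun h => ⟨⟨y, h⟩, x, h⟩, ?_⟩
  rintro ⟨⟨y', h⟩, x', h'⟩
  exact (hF x y' x' y (h.trans h'.symm)).trans h

variable [DecidableEq ι]

/-- The value of `F` at a hard pair of inputs. The selector `d` gives each bit of the random string
`z` to one of the two parties, the other one getting a zero, so that the inputs are disjoint; then
the bits number `j` are overwritten by `a` and `b`. -/
def plant (F : (ι → Bool) → (ι → Bool) → σ) (j : ι) (a b : Bool) (d z : ι → Bool) : σ :=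
  F (Function.update (z ⊓ d) j a) (Function.update (z ⊓ dᶜ) j b)

theorem plant_update_selector (F : (ι → Bool) → (ι → Bool) → σ) (j : ι) (a b c : Bool)
    (d : ι → Bool) : plant F j a b (Function.update d j c) = plant F j a b d := by
  funext z
  simp only [plant]
  congr 1 <;> ext i <;> rcases eq_or_ne i j with rfl | h <;> simp [*]

theorem apply_update_eq_plant (F : (ι → Bool) → (ι → Bool) → σ) (j : ι) (b : Bool)
    (d z : ι → Bool) : F (Function.update z j b ⊓ d) (Function.update z j b ⊓ dᶜ) =
      plant F j (b && d j) (b && !d j) d z := by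
  rw [plant]
  congr 1 <;> ext i <;> rcases eq_or_ne i j with rfl | h <;> simp [*]

theorem exists_update_inf_and_update_inf_compl_iff (j : ι) (b : Bool) (d z : ι → Bool) :
    (∃ i, Function.update (z ⊓ d) j b i = true ∧ Function.update (z ⊓ dᶜ) j b i = true) ↔
      b = true := by
  refine ⟨fun ⟨i, hx, hy⟩ => ?_, fun hb => ⟨j, by simp [hb]⟩⟩
  rcases eq_or_ne i j with rfl | h
  · simpa using hx
  · cases hd : d i <;> simp [h, hd] at hx hy

end Rectangles

section Averaging

variable {ι : Type*} [Fintype ι]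

/-- Exchange the coordinates outside `s` between two points. -/
theorem card_filter_and_mul_card_of_dependsOn [DecidableEq ι] {α : ι → Type*} [∀ i, Fintype (α i)]
    {P Q : (∀ i, α i) → Prop} [DecidablePred P] [DecidablePred Q] {s : Set ι}
    (hP : DependsOn P s) (hQ : DependsOn Q sᶜ) :
    #{z | P z ∧ Q z} * Fintype.card (∀ i, α i) = #{z | P z} * #{z | Q z} := by
  classical
  have hinvol : Function.Involutive fun p : (∀ i, α i) × (∀ i, α i) =>
      (s.piecewise p.1 p.2, s.piecewise p.2 p.1) := by
    rintro ⟨z, w⟩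
    ext i <;> by_cases hi : i ∈ s <;> simp [hi]
  rw [← card_univ, ← card_product, ← card_product]
  refine card_equiv (hinvol.toPerm _) fun p => ?_
  have hPp : P (s.piecewise p.1 p.2) ↔ P p.1 :=
    iff_of_eq (hP fun i hi => Set.piecewise_eq_of_mem _ _ _ hi)
  have hQp : Q (s.piecewise p.2 p.1) ↔ Q p.1 :=
    iff_of_eq (hQ fun i hi => Set.piecewise_eq_of_notMem _ _ _ hi)
  simp [hPp, hQp]

/-- Yao's averaging principle: the easy direction of the minimax theorem for randomized
algorithms. -/
theorem exists_mul_card_le_card_filter_mem {α Ω : Type*} [Fintype α] [MeasurableSpace Ω]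
    (μ : Measure Ω) [IsProbabilityMeasure μ] {E : α → Set Ω} (hE : ∀ a, MeasurableSet (E a)) {p : ℝ}
    (hp : ∀ a, p ≤ μ.real (E a)) [∀ ω, DecidablePred fun a => ω ∈ E a] :
    ∃ ω, p * Fintype.card α ≤ #{a | ω ∈ E a} := by
  have hint (a : α) : Integrable ((E a).indicator (1 : Ω → ℝ)) μ :=
    (integrable_const 1).indicator (hE a)
  obtain ⟨ω, hω⟩ := exists_integral_le (μ := μ) (integrable_finsetSum univ fun a _ => hint a)
  refine ⟨ω, ?_⟩
  calc p * Fintype.card α = ∑ _a : α, p := by simp [mul_comm]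
    _ ≤ ∑ a, μ.real (E a) := sum_le_sum fun a _ => hp a
    _ = ∫ ω, ∑ a, (E a).indicator 1 ω ∂μ := by
        rw [integral_finsetSum univ fun a _ => hint a]
        simp only [integral_indicator_one (hE _)]
    _ ≤ ∑ a, (E a).indicator 1 ω := hω
    _ = #{a | ω ∈ E a} := by simp [Set.indicator_apply]

end Averaging

section CutAndPaste

variable {ι τ : Type*} [Fintype ι] [DecidableEq ι] [DecidableEq τ]

/-- The cut-and-paste property: for a fixed selector the two inputs are independent. -/
theorem IsRectangular.fiberCard_plant_mul {F : (ι → Bool) → (ι → Bool) → τ} (hF : IsRectangular F)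
    (j : ι) (a a' b b' : Bool) (d : ι → Bool) (t : τ) :
    fiberCard (plant F j a b d) t * fiberCard (plant F j a' b' d) t =
      fiberCard (plant F j a b' d) t * fiberCard (plant F j a' b d) t := by
  classical
  let P (a : Bool) (z : ι → Bool) : Prop := ∃ y, F (Function.update (z ⊓ d) j a) y = t
  let Q (b : Bool) (z : ι → Bool) : Prop := ∃ x, F x (Function.update (z ⊓ dᶜ) j b) = t
  have hP (a : Bool) : DependsOn (P a) {i | d i = true} := fun z w hzw => by
    have : z ⊓ d = w ⊓ d := by
      ext i; cases hi : d i <;> simp [hi, hzw]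
    simp only [P, this]
  have hQ (b : Bool) : DependsOn (Q b) {i | d i = true}ᶜ := fun z w hzw => by
    have : z ⊓ dᶜ = w ⊓ dᶜ := by
      ext i; cases hi : d i <;> simp [hi, hzw]
    simp only [Q, this]
  have hprod (a b : Bool) : fiberCard (plant F j a b d) t * Fintype.card (ι → Bool) =
      #{z | P a z} * #{z | Q b z} := by
    have hrect : #{z | plant F j a b d z = t} = #{z | P a z ∧ Q b z} :=
      congrArg card (filter_congr fun z _ => hF.eq_iff _ _ _)
    rw [fiberCard, hrect]
    exact_mod_cast card_filter_and_mul_card_of_dependsOn (hP a) (hQ b)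
  have hcard : (Fintype.card (ι → Bool) : ℝ) ≠ 0 := Nat.cast_ne_zero.mpr Fintype.card_ne_zero
  apply mul_right_cancel₀ (mul_ne_zero hcard hcard)
  rw [mul_mul_mul_comm, hprod, hprod, mul_mul_mul_comm (fiberCard _ _), hprod, hprod]
  ring

theorem IsRectangular.hellingerSq_plant_le [Fintype τ] {F : (ι → Bool) → (ι → Bool) → τ}
    (hF : IsRectangular F) (j : ι) (d : ι → Bool) :
    hellingerSq (fiberCard (plant F j false false d)) (fiberCard (plant F j true true d)) ≤
      2 * (hellingerSq (fiberCard (plant F j true false d)) (fiberCard (plant F j false false d)) +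
        hellingerSq (fiberCard (plant F j false true d))
          (fiberCard (plant F j false false d))) := by
  have hpaste : hellingerSq (fiberCard (plant F j false false d))
      (fiberCard (plant F j true true d)) =
        hellingerSq (fiberCard (plant F j true false d)) (fiberCard (plant F j false true d)) := by
    simp only [hellingerSq_eq_sub (fiberCard_nonneg _) (fiberCard_nonneg _),
      hF.fiberCard_plant_mul j false true false true, sum_fiberCard, mul_comm]
  rw [hpaste]
  exact hellingerSq_le_two_mul_add _ _ _

theorem IsRectangular.sum_hellingerSq_plant_le [Fintype τ] {F : (ι → Bool) → (ι → Bool) → τ}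
    (hF : IsRectangular F) (j : ι) :
    ∑ d, hellingerSq (fiberCard (plant F j false false d)) (fiberCard (plant F j true true d)) ≤
      4 * ∑ d : ι → Bool, hellingerSq
        (fiberCard fun z => F (Function.update z j true ⊓ d) (Function.update z j true ⊓ dᶜ))
        (fiberCard fun z =>
          F (Function.update z j false ⊓ d) (Function.update z j false ⊓ dᶜ)) := by
  let h (a b : Bool) (d : ι → Bool) : ℝ :=
    hellingerSq (fiberCard (plant F j a b d)) (fiberCard (plant F j false false d))
  have hselector (a b c : Bool) : ∑ d, h a b d = 2 * ∑ d with d j = c, h a b d := by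
    rw [← sum_comp_update]
    simp only [h, plant_update_selector]
  calc _ ≤ ∑ d, 2 * (h true false d + h false true d) :=
        sum_le_sum fun d _ => hF.hellingerSq_plant_le j d
    _ = 4 * ∑ d, ((if d j = true then h true false d else 0) +
          if d j = false then h false true d else 0) := by
        rw [← mul_sum, sum_add_distrib, hselector true false true, hselector false true false,
          sum_add_distrib, ← sum_filter, ← sum_filter]
        ring
    _ = _ := by
        refine congrArg _ (sum_congr rfl fun d _ => ?_)
        simp only [apply_update_eq_plant]
        cases d j <;> simp [h]

theorem IsRectangular.sum_sum_hellingerSq_plant_le [Fintype τ]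
    {F : (ι → Bool) → (ι → Bool) → τ} (hF : IsRectangular F) :
    ∑ j, ∑ d, hellingerSq (fiberCard (plant F j false false d))
        (fiberCard (plant F j true true d)) ≤
      16 * ((2 ^ Fintype.card ι) ^ 2 * Real.log (Fintype.card τ)) := by
  calc _ ≤ ∑ j, 4 * ∑ d : ι → Bool, _ := sum_le_sum fun j _ => hF.sum_hellingerSq_plant_le j
    _ = 4 * ∑ d : ι → Bool, ∑ j, _ := by rw [← mul_sum, sum_comm]
    _ ≤ 4 * ∑ d : ι → Bool, 4 * (2 ^ Fintype.card ι * Real.log (Fintype.card τ)) := by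
        gcongr with d
        exact sum_hellingerSq_comp_update_le fun z => F (z ⊓ d) (z ⊓ dᶜ)
    _ = _ := by
        rw [sum_const, card_univ, Fintype.card_fun, Fintype.card_bool, nsmul_eq_mul]
        push_cast
        ring

end CutAndPaste

variable {ι τ : Type*} [Fintype ι] [Fintype τ]

theorem IsRectangular.sum_card_correct_le [DecidableEq ι] {F : (ι → Bool) → (ι → Bool) → τ}
    (hF : IsRectangular F) (O : τ → Prop) [DecidablePred O] :
    ∑ j, ∑ d, ((#{z | ¬ O (plant F j false false d z)} : ℝ) + #{z | O (plant F j true true d z)}) ≤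
      (2 ^ Fintype.card ι) ^ 2 * (96 * Real.log (Fintype.card τ) + 7 / 6 * Fintype.card ι) := by
  classical
  set N : ℝ := 2 ^ Fintype.card ι with hN
  have hcube : (Fintype.card (ι → Bool) : ℝ) = N := by simp [hN]
  have hterm (j : ι) (d : ι → Bool) : (#{z | ¬ O (plant F j false false d z)} : ℝ) +
      #{z | O (plant F j true true d z)} ≤
        6 * hellingerSq (fiberCard (plant F j false false d)) (fiberCard (plant F j true true d)) +
          7 / 6 * N := by
    have hadv := sum_sub_sum_le_hellingerSq (fiberCard_nonneg (plant F j false false d))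
      (fiberCard_nonneg (plant F j true true d)) (c := 12) (by norm_num) {t | ¬ O t}
    simp only [sum_fiberCard_eq_card_filter, mem_filter_univ, mem_univ, filter_true, card_univ,
      hcube] at hadv
    have hcompl : (#{z | O (plant F j true true d z)} : ℝ) +
        #{z | ¬ O (plant F j true true d z)} = N := by
      rw [← hcube]
      exact_mod_cast card_filter_add_card_filter_not (s := univ)
        fun z => O (plant F j true true d z)
    linarith
  calc _ ≤ ∑ j, ∑ d, _ := sum_le_sum fun j _ => sum_le_sum fun d _ => hterm j d
    _ = 6 * ∑ j, ∑ d, hellingerSq (fiberCard (plant F j false false d))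
          (fiberCard (plant F j true true d)) + N ^ 2 * (7 / 6 * Fintype.card ι) := by
        simp only [sum_add_distrib, ← mul_sum, sum_const, card_univ, nsmul_eq_mul, hcube]
        ring
    _ ≤ 6 * (16 * (N ^ 2 * Real.log (Fintype.card τ))) + N ^ 2 * (7 / 6 * Fintype.card ι) := by
        gcongr
        exact hF.sum_sum_hellingerSq_plant_le
    _ = _ := by ring

/-- The randomized communication lower bound for set disjointness; `τ` holds the transcripts. -/
theorem card_le_mul_log_card_of_isRectangular {Ω : Type*} [MeasurableSpace Ω]
    (μ : Measure Ω) [IsProbabilityMeasure μ] {F : Ω → (ι → Bool) → (ι → Bool) → τ}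
    (hF : ∀ ω, IsRectangular (F ω)) {O : τ → Prop}
    (hmeas : ∀ x y, MeasurableSet {ω | O (F ω x y) ↔ ∃ i, x i = true ∧ y i = true})
    (hprob : ∀ x y, 2 / 3 ≤ μ.real {ω | O (F ω x y) ↔ ∃ i, x i = true ∧ y i = true}) :
    (Fintype.card ι : ℝ) ≤ 576 * Real.log (Fintype.card τ) := by
  classical
  set N : ℝ := 2 ^ Fintype.card ι with hN
  let x (a : ι × (ι → Bool) × (ι → Bool) × Bool) := Function.update (a.2.2.1 ⊓ a.2.1) a.1 a.2.2.2
  let y (a : ι × (ι → Bool) × (ι → Bool) × Bool) := Function.update (a.2.2.1 ⊓ a.2.1ᶜ) a.1 a.2.2.2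
  obtain ⟨ω, hω⟩ := exists_mul_card_le_card_filter_mem μ (fun a => hmeas (x a) (y a))
    (fun a => hprob (x a) (y a))
  have hcorrect : (#{a | ω ∈ {ω | O (F ω (x a) (y a)) ↔ ∃ i, x a i = true ∧ y a i = true}} : ℝ) =
      ∑ j, ∑ d, ((#{z | ¬ O (plant (F ω) j false false d z)} : ℝ) +
        #{z | O (plant (F ω) j true true d z)}) := by
    simp only [natCast_card_filter]
    simp only [Fintype.sum_prod_type, Fintype.sum_bool, sum_add_distrib, Set.mem_ofPred_eq, x, y,
      exists_update_inf_and_update_inf_compl_iff, iff_true, Bool.false_eq_true, iff_false, plant]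
    exact add_comm _ _
  have hcard : (Fintype.card (ι × (ι → Bool) × (ι → Bool) × Bool) : ℝ) =
      2 * Fintype.card ι * N ^ 2 := by
    simp [hN]; ring
  have hdet := (hF ω).sum_card_correct_le O
  rw [hcorrect, hcard] at hω
  have hbound : N ^ 2 * (Fintype.card ι : ℝ) ≤ N ^ 2 * (576 * Real.log (Fintype.card τ)) := by
    linarith
  exact le_of_mul_le_mul_left hbound (by positivity)

end Disjointness

/-! ### Two-party simulation of CONGEST algorithms -/

/-- A message of at most `B` bits as a string of exactly `B` symbols, padded with `none`. This makes
the messages easy to count. -/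
def Message.encode {B : ℕ} (w : Message B) : Fin B → Option Bool := fun i => w.1[(i : ℕ)]?

theorem Message.encode_injective {B : ℕ} :
    Function.Injective (Message.encode : Message B → Fin B → Option Bool) := by
  rintro ⟨w, hw⟩ ⟨w', hw'⟩ h
  refine Subtype.ext (List.ext_getElem? fun i => ?_)
  by_cases hi : i < B
  · exact congrFun h ⟨i, hi⟩
  · rw [List.getElem?_eq_none (hw.trans (by omega)), List.getElem?_eq_none (hw'.trans (by omega))]

/-- The graphs `E₀ x ⊔ E₁ y ⊔ S` form a family for a two-party simulation: the vertices are
partitioned into the sides `V₀` and `V₁` of the parties holding `x` and `y`, and only the fixed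
edges `S` connect the two sides. -/
structure IsCutFamily {W X : Type*} (V₀ V₁ : Set W) (E₀ E₁ : X → SimpleGraph W)
    (S : SimpleGraph W) : Prop where
  disjoint : Disjoint V₀ V₁
  cover : V₀ ∪ V₁ = Set.univ
  left : ∀ x u v, (E₀ x).Adj u v → u ∈ V₀ ∧ v ∈ V₀
  right : ∀ x u v, (E₁ x).Adj u v → u ∈ V₁ ∧ v ∈ V₁
  cut : ∀ u v, S.Adj u v → (u ∈ V₀ ∧ v ∈ V₁) ∨ (u ∈ V₁ ∧ v ∈ V₀)

namespace IsCutFamily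

variable {W X : Type*} {V₀ V₁ : Set W} {E₀ E₁ : X → SimpleGraph W} {S : SimpleGraph W}

theorem notMem_right (h : IsCutFamily V₀ V₁ E₀ E₁ S) {v : W} (hv : v ∈ V₀) : v ∉ V₁ :=
  Set.disjoint_left.mp h.disjoint hv

theorem mem_or_mem (h : IsCutFamily V₀ V₁ E₀ E₁ S) (v : W) : v ∈ V₀ ∨ v ∈ V₁ :=
  h.cover.ge (Set.mem_univ v)

theorem symm (h : IsCutFamily V₀ V₁ E₀ E₁ S) : IsCutFamily V₁ V₀ E₁ E₀ S where
  disjoint := h.disjoint.symm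
  cover := by rw [Set.union_comm, h.cover]
  left := h.right
  right := h.left
  cut u v huv := (h.cut u v huv).symm

theorem adj_congr_left (h : IsCutFamily V₀ V₁ E₀ E₁ S) (x y y' : X) {v : W} (hv : v ∈ V₀) (u : W) :
    (E₀ x ⊔ E₁ y ⊔ S).Adj u v ↔ (E₀ x ⊔ E₁ y' ⊔ S).Adj u v := by
  have hright (y : X) : ¬ (E₁ y).Adj u v := fun huv => h.notMem_right hv (h.right y u v huv).2
  simp only [SimpleGraph.sup_adj, hright]

theorem adj_congr_right (h : IsCutFamily V₀ V₁ E₀ E₁ S) (x x' y : X) {v : W} (hv : v ∈ V₁)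
    (u : W) : (E₀ x ⊔ E₁ y ⊔ S).Adj u v ↔ (E₀ x' ⊔ E₁ y ⊔ S).Adj u v := by
  rw [sup_comm (E₀ x), sup_comm (E₀ x')]
  exact h.symm.adj_congr_left y x x' hv u

theorem cut_of_adj (h : IsCutFamily V₀ V₁ E₀ E₁ S) {x y : X} {u v : W} (hu : u ∈ V₁)
    (hv : v ∈ V₀) (huv : (E₀ x ⊔ E₁ y ⊔ S).Adj u v) : S.Adj u v := by
  rcases huv with (huv | huv) | huv
  · exact absurd hu (h.notMem_right (h.left _ _ _ huv).1)
  · exact absurd (h.right _ _ _ huv).2 (h.notMem_right hv)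
  · exact huv

end IsCutFamily

namespace CongestAlgorithm

variable {n B : ℕ} {X : Type*} {V₀ V₁ : Set (Fin n)} {E₀ E₁ : X → SimpleGraph (Fin n)}
  {S : SimpleGraph (Fin n)}

theorem run_zero_congr (A : CongestAlgorithm n B) {G G' : SimpleGraph (Fin n)} {v : Fin n}
    (hadj : ∀ u, G.Adj u v ↔ G'.Adj u v) : A.run G 0 v = A.run G' 0 v := by
  have hnbr : G.neighborSet v = G'.neighborSet v := by
    ext u
    rw [SimpleGraph.mem_neighborSet, SimpleGraph.mem_neighborSet, G.adj_comm, G'.adj_comm, hadj]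
  rw [run, run, hnbr]

theorem run_succ_congr (A : CongestAlgorithm n B) {G G' : SimpleGraph (Fin n)} {t : ℕ} {v : Fin n}
    (hv : A.run G t v = A.run G' t v) (hadj : ∀ u, G.Adj u v ↔ G'.Adj u v)
    (hsend : ∀ u, G'.Adj u v → A.send (A.run G t u) v = A.send (A.run G' t u) v) :
    A.run G (t + 1) v = A.run G' (t + 1) v := by
  simp only [run, hv]
  congr 1
  funext u
  by_cases huv : G'.Adj u v
  · rw [if_pos ((hadj u).2 huv), if_pos huv, hsend u huv]
  · rw [if_neg (mt (hadj u).1 huv), if_neg huv]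

theorem run_mixed (h : IsCutFamily V₀ V₁ E₀ E₁ S) (A : CongestAlgorithm n B) {T : ℕ}
    {x y x' y' : X}
    (hmsg : ∀ t < T, ∀ u v, S.Adj u v → A.send (A.run (E₀ x ⊔ E₁ y ⊔ S) t u) v =
      A.send (A.run (E₀ x' ⊔ E₁ y' ⊔ S) t u) v) :
    ∀ t ≤ T, (∀ v ∈ V₀, A.run (E₀ x ⊔ E₁ y' ⊔ S) t v = A.run (E₀ x ⊔ E₁ y ⊔ S) t v) ∧
      ∀ v ∈ V₁, A.run (E₀ x ⊔ E₁ y' ⊔ S) t v = A.run (E₀ x' ⊔ E₁ y' ⊔ S) t v := by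
  intro t
  induction t with
  | zero => exact fun _ => ⟨fun v hv => A.run_zero_congr (h.adj_congr_left x y' y hv),
      fun v hv => A.run_zero_congr (h.adj_congr_right x x' y' hv)⟩
  | succ t ih =>
    intro ht
    obtain ⟨hleft, hright⟩ := ih (by omega)
    refine ⟨fun v hv => A.run_succ_congr (hleft v hv) (h.adj_congr_left x y' y hv) fun u huv => ?_,
      fun v hv => A.run_succ_congr (hright v hv) (h.adj_congr_right x x' y' hv) fun u huv => ?_⟩
    · rcases h.mem_or_mem u with hu | hu
      · rw [hleft u hu]
      · rw [hright u hu, hmsg t ht u v (h.cut_of_adj hu hv huv)]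
    · rcases h.mem_or_mem u with hu | hu
      · rw [sup_comm (E₀ x')] at huv
        rw [hleft u hu, hmsg t ht u v (h.symm.cut_of_adj hu hv huv)]
      · rw [hright u hu]

/-- The possible transcripts of a two-party simulation of `T` rounds: the messages of at most `B`
bits that cross the cut `S`, and one output bit for each side. -/
abbrev Transcript {n : ℕ} (S : SimpleGraph (Fin n)) (B T : ℕ) : Type :=
  (Fin T × S.Dart → Fin B → Option Bool) × Bool × Bool

theorem card_transcript [DecidableRel S.Adj] (T : ℕ) :
    Fintype.card (Transcript S B T) = 3 ^ (2 * S.edgeSet.ncard * T * B) * 4 := by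
  have hdart : Fintype.card S.Dart = 2 * S.edgeSet.ncard := by
    rw [S.dart_card_eq_twice_card_edges, Set.ncard_eq_toFinset_card', SimpleGraph.edgeFinset]
  simp only [Fintype.card_prod, Fintype.card_pi, Finset.prod_const, Finset.card_univ,
    Fintype.card_option, Fintype.card_bool, Fintype.card_fin, hdart, ← pow_mul]
  ring

open Classical in
/-- The transcript of the two-party simulation of the first `T` rounds of `A` on `G`, where the
output bit of a side tells whether one of its nodes accepts. -/
noncomputable def transcript (A : CongestAlgorithm n B) (T : ℕ) (V₀ V₁ : Set (Fin n))
    (S G : SimpleGraph (Fin n)) : Transcript S B T :=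
  (fun q => (A.send (A.run G q.1 q.2.fst) q.2.snd).encode,
    decide (∃ v ∈ V₀, A.output (A.run G T v) = true),
    decide (∃ v ∈ V₁, A.output (A.run G T v) = true))

theorem isRectangular_transcript (h : IsCutFamily V₀ V₁ E₀ E₁ S) (A : CongestAlgorithm n B)
    (T : ℕ) : IsRectangular fun x y => A.transcript T V₀ V₁ S (E₀ x ⊔ E₁ y ⊔ S) := by
  intro x y x' y' heq
  simp only [transcript, Prod.mk.injEq, decide_eq_decide] at heq ⊢
  obtain ⟨hencode, -, hright⟩ := heq
  have hmsg (t : ℕ) (ht : t < T) (u v : Fin n) (huv : S.Adj u v) :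
      A.send (A.run (E₀ x ⊔ E₁ y ⊔ S) t u) v = A.send (A.run (E₀ x' ⊔ E₁ y' ⊔ S) t u) v :=
    Message.encode_injective (congrFun hencode (⟨t, ht⟩, ⟨(u, v), huv⟩))
  have hrun := A.run_mixed h hmsg
  refine ⟨?_, ?_, ?_⟩
  · funext ⟨⟨t, ht⟩, ⟨⟨u, v⟩, huv⟩⟩
    rcases h.mem_or_mem u with hu | hu
    · rw [(hrun t ht.le).1 u hu]
    · rw [(hrun t ht.le).2 u hu, hmsg t ht u v huv]
  · exact exists_congr fun v => and_congr_right fun hv => by rw [(hrun T le_rfl).1 v hv]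
  · rw [hright]
    exact exists_congr fun v => and_congr_right fun hv => by rw [(hrun T le_rfl).2 v hv]

theorem transcript_output_iff_accepts (h : IsCutFamily V₀ V₁ E₀ E₁ S) (A : CongestAlgorithm n B)
    (T : ℕ) (G : SimpleGraph (Fin n)) :
    ((A.transcript T V₀ V₁ S G).2.1 = true ∨ (A.transcript T V₀ V₁ S G).2.2 = true) ↔
      A.Accepts T G := by
  simp only [Accepts, transcript, decide_eq_true_eq, ← exists_or, ← or_and_right, h.mem_or_mem,
    true_and]

end CongestAlgorithm

theorem DeterministicallySolvable.randomizedSolvable {n B T : ℕ} {P : SimpleGraph (Fin n) → Prop}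
    (h : DeterministicallySolvable P B T) : RandomizedSolvable P B T := by
  obtain ⟨A, hA⟩ := h
  refine ⟨Unit, ⊤, Measure.dirac (), inferInstance, fun _ => A, fun G => ⟨trivial, ?_⟩⟩
  have huniv : {_ω : Unit | A.Accepts T G ↔ P G} = Set.univ := Set.eq_univ_of_forall fun _ => hA G
  rw [huniv, measure_univ]
  exact ENNReal.div_le_of_le_mul (by norm_num)

/-- The two parties simulate the algorithm on their sides of the graph, and only have to exchange
the messages that cross `S`. -/
theorem RandomizedSolvable.le_of_isCutFamily {n B T m : ℕ} {P : SimpleGraph (Fin n) → Prop}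
    (hP : RandomizedSolvable P B T) {V₀ V₁ : Set (Fin n)}
    {E₀ E₁ : (Fin m → Bool) → SimpleGraph (Fin n)} {S : SimpleGraph (Fin n)}
    (h : IsCutFamily V₀ V₁ E₀ E₁ S)
    (hdisj : ∀ x y, P (E₀ x ⊔ E₁ y ⊔ S) ↔ ∃ i, x i = true ∧ y i = true) :
    (m : ℝ) ≤ 576 * (2 * S.edgeSet.ncard * (T * B) * Real.log 3 + Real.log 4) := by
  classical
  obtain ⟨Ω, _, μ, _, A, hA⟩ := hP
  have hlower := card_le_mul_log_card_of_isRectangular μ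
    (O := fun t : CongestAlgorithm.Transcript S B T => t.2.1 = true ∨ t.2.2 = true)
    (fun ω => (A ω).isRectangular_transcript h T)
    (fun x y => by
      simpa only [(A _).transcript_output_iff_accepts h, hdisj] using (hA (E₀ x ⊔ E₁ y ⊔ S)).1)
    (fun x y => by
      simp only [(A _).transcript_output_iff_accepts h, ← hdisj]
      simpa [measureReal_def] using
        ENNReal.toReal_mono (measure_ne_top μ _) (hA (E₀ x ⊔ E₁ y ⊔ S)).2)
  rw [Fintype.card_fin, CongestAlgorithm.card_transcript, Nat.cast_mul, Nat.cast_pow,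
    Nat.cast_ofNat, Nat.cast_ofNat, Real.log_mul (by positivity) (by norm_num),
    Real.log_pow] at hlower
  convert hlower using 3
  push_cast
  ring

/-! ### The lower bound graphs -/

section HostGraph

/-- Vertices of the lower bound graphs. `Sum.inl (b, i, l, u)` is the node with label `l` of the
triangle for the word `u : Fin k → Fin s` in the group `i` of triangles on side `b`.
`Sum.inr (b, i, j, c)` is the node on side `b` adjacent to the triangles in the group `i` whose word
has the letter `c` at position `j`. -/
abbrev HostVertex (k s : ℕ) : Type :=
  (Fin 2 × Fin 2 × Fin 3 × (Fin k → Fin s)) ⊕ (Fin 2 × Fin 2 × Fin k × Fin s)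

variable {k s : ℕ}

/-- The part of the lower bound graph on side `a`. An input is a relation `R` on words, and
`R u u'` says that there is an edge between the triangle for `u` in group `0` and the one for `u'`
in group `1`. -/
def hostSide (a : Fin 2) (R : (Fin k → Fin s) → (Fin k → Fin s) → Prop) :
    SimpleGraph (HostVertex k s) where
  Adj
    | .inl (b, i, l, u), .inl (b', i', l', u') => b = a ∧ b' = a ∧
        ((i = i' ∧ u = u' ∧ l ≠ l') ∨
          (l = 0 ∧ l' = 0 ∧ ((i = 0 ∧ i' = 1 ∧ R u u') ∨ (i = 1 ∧ i' = 0 ∧ R u' u))))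
    | .inl (b, i, l, u), .inr (b', i', j, c) => b = a ∧ b' = a ∧ i = i' ∧ l = 1 ∧ u j = c
    | .inr (b', i', j, c), .inl (b, i, l, u) => b = a ∧ b' = a ∧ i = i' ∧ l = 1 ∧ u j = c
    | .inr _, .inr _ => False
  symm := ⟨by
    rintro (⟨b, i, l, u⟩ | ⟨b, i, j, c⟩) (⟨b', i', l', u'⟩ | ⟨b', i', j', c'⟩) h <;>
      simp only at h ⊢ <;> grind⟩
  loopless := ⟨by
    rintro (⟨b, i, l, u⟩ | ⟨b, i, j, c⟩) h <;> simp only at h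
    grind⟩

/-- The edges of the lower bound graph between the two sides: a matching of the letter nodes. -/
def hostCut (k s : ℕ) : SimpleGraph (HostVertex k s) where
  Adj
    | .inr (b, i, j, c), .inr (b', i', j', c') => b ≠ b' ∧ i = i' ∧ j = j' ∧ c = c'
    | _, _ => False
  symm := ⟨by
    rintro (⟨b, i, l, u⟩ | ⟨b, i, j, c⟩) (⟨b', i', l', u'⟩ | ⟨b', i', j', c'⟩) h <;>
      simp only at h ⊢
    grind⟩
  loopless := ⟨by
    rintro (⟨b, i, l, u⟩ | ⟨b, i, j, c⟩) h <;> simp only at h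
    grind⟩

/-- The lower bound graph in which side `b` has the input `R b`. -/
def hostGraph (R : Fin 2 → (Fin k → Fin s) → (Fin k → Fin s) → Prop) :
    SimpleGraph (HostVertex k s) :=
  hostSide 0 (R 0) ⊔ hostSide 1 (R 1) ⊔ hostCut k s

namespace hostGraph

variable {R : Fin 2 → (Fin k → Fin s) → (Fin k → Fin s) → Prop}

theorem adj_inl_inl {b b' i i' : Fin 2} {l l' : Fin 3} {u u' : Fin k → Fin s} :
    (hostGraph R).Adj (.inl (b, i, l, u)) (.inl (b', i', l', u')) ↔ b = b' ∧
      ((i = i' ∧ u = u' ∧ l ≠ l') ∨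
        (l = 0 ∧ l' = 0 ∧ ((i = 0 ∧ i' = 1 ∧ R b u u') ∨ (i = 1 ∧ i' = 0 ∧ R b u' u)))) := by
  fin_cases b <;> fin_cases b' <;> simp [hostGraph, hostSide, hostCut]

theorem adj_inl_inr {b b' i i' : Fin 2} {l : Fin 3} {u : Fin k → Fin s} {j : Fin k} {c : Fin s} :
    (hostGraph R).Adj (.inl (b, i, l, u)) (.inr (b', i', j, c)) ↔
      b = b' ∧ i = i' ∧ l = 1 ∧ u j = c := by
  fin_cases b <;> fin_cases b' <;> simp [hostGraph, hostSide, hostCut]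

theorem adj_inr_inl {b b' i i' : Fin 2} {l : Fin 3} {u : Fin k → Fin s} {j : Fin k} {c : Fin s} :
    (hostGraph R).Adj (.inr (b', i', j, c)) (.inl (b, i, l, u)) ↔
      b = b' ∧ i = i' ∧ l = 1 ∧ u j = c := by
  rw [SimpleGraph.adj_comm, adj_inl_inr]

theorem adj_inr_inr {b b' i i' : Fin 2} {j j' : Fin k} {c c' : Fin s} :
    (hostGraph R).Adj (.inr (b, i, j, c)) (.inr (b', i', j', c')) ↔
      b ≠ b' ∧ i = i' ∧ j = j' ∧ c = c' := by
  simp [hostGraph, hostSide, hostCut]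

theorem exists_eq_inl_of_triangle {v : Fin 3 → HostVertex k s}
    (h : ∀ l l', l ≠ l' → (hostGraph R).Adj (v l) (v l')) :
    ∃ b i u, ∃ g : Fin 3 → Fin 3, ∀ l, v l = .inl (b, i, g l, u) := by
  have h01 := h 0 1 (by decide)
  have h02 := h 0 2 (by decide)
  have h12 := h 1 2 (by decide)
  rcases hv0 : v 0 with ⟨b0, i0, l0, u0⟩ | ⟨b0, i0, j0, c0⟩ <;>
  rcases hv1 : v 1 with ⟨b1, i1, l1, u1⟩ | ⟨b1, i1, j1, c1⟩ <;>
  rcases hv2 : v 2 with ⟨b2, i2, l2, u2⟩ | ⟨b2, i2, j2, c2⟩ <;>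
  rw [hv0, hv1] at h01 <;> rw [hv0, hv2] at h02 <;> rw [hv1, hv2] at h12 <;>
  simp only [adj_inl_inl, adj_inl_inr, adj_inr_inl, adj_inr_inr] at h01 h02 h12
  · refine ⟨b0, i0, u0, ![l0, l1, l2], fun l => ?_⟩
    have hsame : b1 = b0 ∧ i1 = i0 ∧ u1 = u0 ∧ b2 = b0 ∧ i2 = i0 ∧ u2 = u0 := by grind
    obtain ⟨rfl, rfl, rfl, rfl, rfl, rfl⟩ := hsame
    fin_cases l <;> simp [hv0, hv1, hv2]
  all_goals grind

/-- Where a homomorphism from the pattern sends the triangles: number `i` on side `a` goes to the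
triangle for `word a i` in the group `group a i` on side `side a i`, with its labels permuted. -/
structure TrianglePlacement (f : patternGraph k →g hostGraph R) where
  side : Fin 2 → Fin 2 → Fin 2
  group : Fin 2 → Fin 2 → Fin 2
  word : Fin 2 → Fin 2 → Fin k → Fin s
  perm : Fin 2 → Fin 2 → Equiv.Perm (Fin 3)
  apply_inl : ∀ a i l, f (.inl (a, i, l)) = .inl (side a i, group a i, perm a i l, word a i)

theorem nonempty_trianglePlacement {f : patternGraph k →g hostGraph R}
    (hf : Function.Injective f) : Nonempty (TrianglePlacement f) := by
  have htriangle (a i : Fin 2) : ∃ b i' u, ∃ g : Fin 3 → Fin 3,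
      ∀ l, f (.inl (a, i, l)) = .inl (b, i', g l, u) :=
    exists_eq_inl_of_triangle fun l l' hl => f.map_adj ⟨rfl, .inl ⟨rfl, hl⟩⟩
  choose b i' u g hg using htriangle
  have hinj (a i : Fin 2) : Function.Injective (g a i) := fun l l' h => by
    have : (Sum.inl (a, i, l) : PatternVertex k) = .inl (a, i, l') := hf (by rw [hg, hg, h])
    simpa using this
  exact ⟨b, i', u, fun a i => .ofBijective _ (Finite.injective_iff_bijective.mp (hinj a i)), hg⟩

namespace TrianglePlacement

variable {f : patternGraph k →g hostGraph R} (p : TrianglePlacement f) (hf : Function.Injective f)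

include p hf

theorem exists_eq_inl_of_apply_eq {a i : Fin 2} {x : PatternVertex k} {l : Fin 3}
    (h : f x = .inl (p.side a i, p.group a i, l, p.word a i)) : ∃ l', x = .inl (a, i, l') :=
  ⟨(p.perm a i).symm l, hf (by rw [h, p.apply_inl, Equiv.apply_symm_apply])⟩

theorem bridge (a : Fin 2) {i i' : Fin 2} (hi : i ≠ i') :
    p.side a i = p.side a i' ∧ p.perm a i 0 = 0 ∧
      ((p.group a i = 0 ∧ p.group a i' = 1 ∧ R (p.side a i) (p.word a i) (p.word a i')) ∨
        (p.group a i = 1 ∧ p.group a i' = 0 ∧ R (p.side a i) (p.word a i') (p.word a i))) := by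
  have hadj : (hostGraph R).Adj (f (.inl (a, i, 0))) (f (.inl (a, i', 0))) :=
    f.map_adj ⟨rfl, .inr ⟨hi, rfl, rfl⟩⟩
  rw [p.apply_inl, p.apply_inl, adj_inl_inl] at hadj
  obtain ⟨hside, ⟨hgroup, hword, -⟩ | ⟨hperm, -, hR⟩⟩ := hadj
  · obtain ⟨l, hl⟩ := p.exists_eq_inl_of_apply_eq hf (a := a) (i := i) (x := .inl (a, i', 0))
      (by rw [p.apply_inl, hside, hgroup, hword])
    simp [hi.symm] at hl
  · exact ⟨hside, hperm, hR⟩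

theorem perm_one_ne_zero (a i : Fin 2) : p.perm a i 1 ≠ 0 := by
  have hzero : p.perm a i 0 = 0 := (p.bridge hf a (i' := i + 1) (by fin_cases i <;> decide)).2.1
  rw [← hzero]
  exact (p.perm a i).injective.ne one_ne_zero

theorem exists_apply_inr (a i : Fin 2) (q : Fin k) :
    ∃ j, f (.inr (a, i, q)) = .inr (p.side a i, p.group a i, j, p.word a i j) := by
  have hadj : (hostGraph R).Adj (f (.inl (a, i, 1))) (f (.inr (a, i, q))) :=
    f.map_adj ⟨rfl, rfl, rfl⟩
  rw [p.apply_inl] at hadj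
  rcases hv : f (.inr (a, i, q)) with ⟨b, i', l, u⟩ | ⟨b, i', j, c⟩
  · rw [hv, adj_inl_inl] at hadj
    obtain ⟨rfl, ⟨rfl, rfl, -⟩ | ⟨hzero, -⟩⟩ := hadj
    · simpa using p.exists_eq_inl_of_apply_eq hf hv
    · exact absurd hzero (p.perm_one_ne_zero hf a i)
  · rw [hv, adj_inl_inr] at hadj
    obtain ⟨rfl, rfl, -, rfl⟩ := hadj
    exact ⟨j, rfl⟩

theorem cut_edge (i : Fin 2) (q : Fin k) :
    p.side 0 i ≠ p.side 1 i ∧ p.group 0 i = p.group 1 i ∧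
      ∃ j, f (.inr (0, i, q)) = .inr (p.side 0 i, p.group 0 i, j, p.word 0 i j) ∧
        p.word 0 i j = p.word 1 i j := by
  have hadj : (hostGraph R).Adj (f (.inr (0, i, q))) (f (.inr (1, i, q))) :=
    f.map_adj ⟨zero_ne_one, rfl, rfl⟩
  obtain ⟨j, hj⟩ := p.exists_apply_inr hf 0 i q
  obtain ⟨j', hj'⟩ := p.exists_apply_inr hf 1 i q
  rw [hj, hj', adj_inr_inr] at hadj
  obtain ⟨hside, hgroup, rfl, hword⟩ := hadj
  exact ⟨hside, hgroup, j, hj, hword⟩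

/-- The `k` paths between two triangles use `k` different positions, hence all of them. -/
theorem word_eq (i : Fin 2) : p.word 0 i = p.word 1 i := by
  choose J hJ hword using fun q => (p.cut_edge hf i q).2.2
  have hinj : Function.Injective J := fun q q' h => by
    have : (Sum.inr (0, i, q) : PatternVertex k) = .inr (0, i, q') := hf (by rw [hJ, hJ, h])
    simpa using this
  funext j
  obtain ⟨q, rfl⟩ := Finite.surjective_of_injective hinj j
  exact hword q

theorem exists_forall_rel (hk : 1 ≤ k) : ∃ u v, ∀ b, R b u v := by
  obtain ⟨hside, hgroup0, -⟩ := p.cut_edge hf 0 ⟨0, hk⟩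
  obtain ⟨-, hgroup1, -⟩ := p.cut_edge hf 1 ⟨0, hk⟩
  have hinj : Function.Injective fun a => p.side a 0 := by
    intro a a' h
    fin_cases a <;> fin_cases a' <;> first | rfl | exact absurd h hside | exact absurd h.symm hside
  have hsurj := Finite.surjective_of_injective hinj
  have hgroup (a i : Fin 2) : p.group a i = p.group 0 i := by
    fin_cases a <;> fin_cases i <;> simp [hgroup0, hgroup1]
  have hword (a i : Fin 2) : p.word a i = p.word 0 i := by
    fin_cases a <;> simp [p.word_eq hf i]
  have hbridge (a : Fin 2) := (p.bridge hf a zero_ne_one).2.2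
  simp only [hgroup, hword] at hbridge
  rcases eq_or_ne (p.group 0 0) 0 with h | h
  · refine ⟨p.word 0 0, p.word 0 1, hsurj.forall.mpr fun a => ?_⟩
    exact ((hbridge a).resolve_right fun h' => zero_ne_one (h.symm.trans h'.1)).2.2
  · refine ⟨p.word 0 1, p.word 0 0, hsurj.forall.mpr fun a => ?_⟩
    exact ((hbridge a).resolve_left fun h' => h h'.1).2.2

end TrianglePlacement

theorem exists_forall_rel_of_isContained (hk : 1 ≤ k)
    (h : (patternGraph k).IsContained (hostGraph R)) : ∃ u v, ∀ b, R b u v := by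
  obtain ⟨f⟩ := h
  obtain ⟨p⟩ := nonempty_trianglePlacement (f := f.toHom) f.injective
  exact p.exists_forall_rel f.injective hk

theorem isIndContained_of_forall_rel {u v : Fin k → Fin s} (h : ∀ b, R b u v) :
    (patternGraph k).IsIndContained (hostGraph R) := by
  let word : Fin 2 → Fin k → Fin s := ![u, v]
  let f : PatternVertex k → HostVertex k s
    | .inl (a, i, l) => .inl (a, i, l, word i)
    | .inr (a, i, p) => .inr (a, i, p, word i p)
  have hinj : Function.Injective f := by
    rintro (⟨a, i, l⟩ | ⟨a, i, p⟩) (⟨a', i', l'⟩ | ⟨a', i', p'⟩) hxy <;> simp [f] at hxy ⊢ <;> tauto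
  have hadj (x y : PatternVertex k) :
      (hostGraph R).Adj (f x) (f y) ↔ (patternGraph k).Adj x y := by
    rcases x with ⟨a, i, l⟩ | ⟨a, i, p⟩ <;> rcases y with ⟨a', i', l'⟩ | ⟨a', i', p'⟩ <;>
      simp only [f, adj_inl_inl, adj_inl_inr, adj_inr_inl, adj_inr_inr, patternGraph]
    · fin_cases i <;> fin_cases i' <;> simp [word, h]
    all_goals grind
  exact ⟨⟨⟨f, hinj⟩, hadj _ _⟩⟩

end hostGraph

/-- The side of a vertex of the lower bound graph, that is, the party that simulates it. -/
def HostVertex.side : HostVertex k s → Fin 2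
  | .inl (a, _) => a
  | .inr (a, _) => a

theorem HostVertex.side_of_hostSide_adj {a : Fin 2} {R : (Fin k → Fin s) → (Fin k → Fin s) → Prop}
    {x y : HostVertex k s} (h : (hostSide a R).Adj x y) : x.side = a ∧ y.side = a := by
  rcases x with ⟨b, i, l, u⟩ | ⟨b, i, j, c⟩ <;>
  rcases y with ⟨b', i', l', u'⟩ | ⟨b', i', j', c'⟩ <;>
  simp only [hostSide] at h
  all_goals first | exact ⟨h.1, h.2.1⟩ | exact ⟨h.2.1, h.1⟩

theorem HostVertex.side_ne_of_hostCut_adj {x y : HostVertex k s} (h : (hostCut k s).Adj x y) :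
    x.side ≠ y.side := by
  rcases x with ⟨b, i, l, u⟩ | ⟨b, i, j, c⟩ <;>
  rcases y with ⟨b', i', l', u'⟩ | ⟨b', i', j', c'⟩ <;>
  simp only [hostCut] at h
  exact h.1

theorem isCutFamily_hostSide (k s : ℕ) :
    IsCutFamily {x : HostVertex k s | x.side = 0} {x | x.side = 1} (hostSide 0) (hostSide 1)
      (hostCut k s) where
  disjoint := Set.disjoint_left.mpr fun x h h' => zero_ne_one (h.symm.trans h')
  cover := Set.eq_univ_of_forall fun x => by
    simp only [Set.mem_union, Set.mem_ofPred_eq]; omega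
  left _ _ _ h := HostVertex.side_of_hostSide_adj h
  right _ _ _ h := HostVertex.side_of_hostSide_adj h
  cut x y h := by
    have := HostVertex.side_ne_of_hostCut_adj h
    simp only [Set.mem_ofPred_eq]; omega

theorem ncard_edgeSet_hostCut (k s : ℕ) : (hostCut k s).edgeSet.ncard = 2 * (k * s) := by
  let edge (q : Fin 2 × Fin k × Fin s) : Sym2 (HostVertex k s) := s(.inr (0, q), .inr (1, q))
  have hinj : Function.Injective edge := by
    intro q q' h
    simpa [edge] using h
  have hrange : (hostCut k s).edgeSet = Set.range edge := by
    ext z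
    induction z with | _ x y
    refine ⟨fun h => ?_, ?_⟩
    · rcases x with ⟨a, i, l, u⟩ | ⟨a, i, j, c⟩ <;>
      rcases y with ⟨a', i', l', u'⟩ | ⟨a', i', j', c'⟩ <;>
      simp only [SimpleGraph.mem_edgeSet, hostCut] at h
      obtain ⟨hside, rfl, rfl, rfl⟩ := h
      refine ⟨(i, j, c), ?_⟩
      fin_cases a <;> fin_cases a' <;> simp [edge, Sym2.eq_swap] at hside ⊢
    · rintro ⟨q, h⟩
      have hadj : (hostCut k s).Adj (.inr (0, q)) (.inr (1, q)) := ⟨zero_ne_one, rfl, rfl, rfl⟩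
      rwa [← h]
  rw [hrange, Set.ncard_range_of_injective hinj, Nat.card_eq_fintype_card, Fintype.card_prod,
    Fintype.card_prod, Fintype.card_fin, Fintype.card_fin, Fintype.card_fin]

theorem card_hostVertex_le {n : ℕ} (hk : 1 ≤ k) (h : (12 + 4 * k) * s ^ k ≤ n) :
    Fintype.card (HostVertex k s) ≤ n := by
  simp only [Fintype.card_sum, Fintype.card_prod, Fintype.card_fin, Fintype.card_fun]
  nlinarith [Nat.le_self_pow (by omega : k ≠ 0) s]

end HostGraph

section Transport

theorem isContained_map_iff {U V W : Type*} {H : SimpleGraph U} {G : SimpleGraph V} (e : V ↪ W)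
    (hH : ∀ x, ∃ y, H.Adj x y) : H.IsContained (G.map e) ↔ H.IsContained G := by
  refine ⟨fun ⟨f⟩ => ?_, fun h => h.trans (SimpleGraph.Embedding.map e G).isContained⟩
  have hrange (x : U) : ∃ v, e v = f x := by
    obtain ⟨y, hxy⟩ := hH x
    obtain ⟨v, _, _, hv, _⟩ := (SimpleGraph.map_adj e _ _ _).1 (f.toHom.map_adj hxy)
    exact ⟨v, hv⟩
  choose g hg using hrange
  refine ⟨⟨g, fun {x y} hxy => ?_⟩, fun x y hxy => f.injective ?_⟩
  · have hadj : (G.map e).Adj (f x) (f y) := f.toHom.map_adj hxy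
    rwa [← hg, ← hg, SimpleGraph.map_adj_apply] at hadj
  · change f x = f y
    rw [← hg, ← hg]
    exact congrArg e hxy

theorem patternGraph.exists_adj {k : ℕ} (x : PatternVertex k) : ∃ y, (patternGraph k).Adj x y := by
  rcases x with ⟨a, i, l⟩ | ⟨a, i, p⟩
  · exact ⟨.inl (a, i, l + 1), rfl, .inl ⟨rfl, by fin_cases l <;> decide⟩⟩
  · exact ⟨.inl (a, i, 1), rfl, rfl, rfl⟩

theorem map_sup_eq {V W : Type*} (e : V ↪ W) (G H : SimpleGraph V) :
    (G ⊔ H).map e = G.map e ⊔ H.map e := by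
  ext u v
  simp only [SimpleGraph.map_adj, SimpleGraph.sup_adj, ← exists_or, or_and_right]

/-- The vertices that are not in the image of `e` are added to the first side. -/
theorem IsCutFamily.map {V W X : Type*} {V₀ V₁ : Set V} {E₀ E₁ : X → SimpleGraph V}
    {S : SimpleGraph V} (h : IsCutFamily V₀ V₁ E₀ E₁ S) (e : V ↪ W) :
    IsCutFamily (e '' V₁)ᶜ (e '' V₁) (fun x => (E₀ x).map e) (fun x => (E₁ x).map e)
      (S.map e) where
  disjoint := disjoint_compl_left
  cover := Set.compl_union_self _
  left x := by
    rintro _ _ ⟨-, u, v, huv, rfl, rfl⟩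
    simp only [Set.mem_compl_iff, e.injective.mem_set_image]
    exact (h.left x u v huv).imp h.notMem_right h.notMem_right
  right x := by
    rintro _ _ ⟨-, u, v, huv, rfl, rfl⟩
    simp only [e.injective.mem_set_image]
    exact h.right x u v huv
  cut := by
    rintro _ _ ⟨-, u, v, huv, rfl, rfl⟩
    simp only [Set.mem_compl_iff, e.injective.mem_set_image]
    exact (h.cut u v huv).imp (And.imp_left h.notMem_right) (And.imp_right h.notMem_right)

theorem IsCutFamily.comp {V X Y : Type*} {V₀ V₁ : Set V} {E₀ E₁ : X → SimpleGraph V}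
    {S : SimpleGraph V} (h : IsCutFamily V₀ V₁ E₀ E₁ S) (g : Y → X) :
    IsCutFamily V₀ V₁ (E₀ ∘ g) (E₁ ∘ g) S where
  disjoint := h.disjoint
  cover := h.cover
  left y := h.left (g y)
  right y := h.right (g y)
  cut := h.cut

end Transport

theorem exists_isCutFamily {k s n : ℕ} (hk : 1 ≤ k) (h : (12 + 4 * k) * s ^ k ≤ n) :
    ∃ (V₀ V₁ : Set (Fin n)) (E₀ E₁ : (Fin (s ^ k * s ^ k) → Bool) → SimpleGraph (Fin n))
      (S : SimpleGraph (Fin n)),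
      IsCutFamily V₀ V₁ E₀ E₁ S ∧ S.edgeSet.ncard = 2 * (k * s) ∧
      ∀ x y,
        (HasCopy (patternGraph k) n (E₀ x ⊔ E₁ y ⊔ S) ↔ ∃ i, x i = true ∧ y i = true) ∧
        (HasInducedCopy (patternGraph k) n (E₀ x ⊔ E₁ y ⊔ S) ↔ ∃ i, x i = true ∧ y i = true) := by
  obtain ⟨e⟩ : Nonempty (HostVertex k s ↪ Fin n) :=
    Function.Embedding.nonempty_of_card_le (by simpa using card_hostVertex_le hk h)
  let φ : (Fin k → Fin s) × (Fin k → Fin s) ≃ Fin (s ^ k * s ^ k) :=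
    Fintype.equivFinOfCardEq (by simp)
  let rel (x : Fin (s ^ k * s ^ k) → Bool) (u v : Fin k → Fin s) : Prop := x (φ (u, v)) = true
  refine ⟨_, _, _, _, _, ((isCutFamily_hostSide k s).map e).comp rel, ?_, fun x y => ?_⟩
  · rw [SimpleGraph.edgeSet_map, Set.ncard_image_of_injective _ (Function.Embedding.injective _),
      ncard_edgeSet_hostCut]
  · have hunion : (hostSide 0 (rel x)).map e ⊔ (hostSide 1 (rel y)).map e ⊔ (hostCut k s).map e =
        (hostGraph ![rel x, rel y]).map e := by
      rw [hostGraph, map_sup_eq, map_sup_eq]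
      rfl
    have hcommon : (∃ i, x i = true ∧ y i = true) ↔ ∃ u v, ∀ b, ![rel x, rel y] b u v := by
      simp only [← φ.exists_congr_right, Prod.exists, Fin.forall_fin_two]
      rfl
    have hcopy : HasCopy (patternGraph k) n ((hostGraph ![rel x, rel y]).map e) →
        ∃ u v, ∀ b, ![rel x, rel y] b u v := fun h =>
      hostGraph.exists_forall_rel_of_isContained hk
        ((isContained_map_iff e patternGraph.exists_adj).mp h)
    have hinduced : (∃ u v, ∀ b, ![rel x, rel y] b u v) →
        HasInducedCopy (patternGraph k) n ((hostGraph ![rel x, rel y]).map e) :=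
      fun ⟨_, _, huv⟩ => (hostGraph.isIndContained_of_forall_rel huv).trans
        ⟨SimpleGraph.Embedding.map e _⟩
    have hforget : HasInducedCopy (patternGraph k) n ((hostGraph ![rel x, rel y]).map e) →
        HasCopy (patternGraph k) n ((hostGraph ![rel x, rel y]).map e) := fun ⟨f⟩ => ⟨f.toCopy⟩
    simp only [Function.comp_apply, hunion, hcommon]
    exact ⟨⟨hcopy, hforget ∘ hinduced⟩, ⟨hcopy ∘ hforget, hinduced⟩⟩

/-! ### Parameters -/

section Parameters

/-- The alphabet size of the lower bound graph on `n` vertices: the largest one for which the graph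
has at most `n` vertices. -/
def alphabetSize (k n : ℕ) : ℕ := Nat.findGreatest (fun s => (12 + 4 * k) * s ^ k ≤ n) n

variable {k : ℕ}

theorem mul_alphabetSize_pow_le (hk : 1 ≤ k) (n : ℕ) :
    (12 + 4 * k) * alphabetSize k n ^ k ≤ n :=
  Nat.findGreatest_spec (P := fun s => (12 + 4 * k) * s ^ k ≤ n) (Nat.zero_le n)
    (by rw [zero_pow (by omega)]; omega)

theorem lt_mul_alphabetSize_succ_pow (hk : 1 ≤ k) (n : ℕ) :
    n < (12 + 4 * k) * (alphabetSize k n + 1) ^ k := by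
  by_cases h : alphabetSize k n + 1 ≤ n
  · exact not_le.mp (Nat.findGreatest_is_greatest
      (P := fun s => (12 + 4 * k) * s ^ k ≤ n) (Nat.lt_succ_self _) h)
  · have : alphabetSize k n + 1 ≤ (alphabetSize k n + 1) ^ k := Nat.le_self_pow (by omega) _
    nlinarith

/-- A bound for the ratio between the number of vertices and the number of words. The factor `2 ^ k`
pays for the rounding of the alphabet size. -/
def sizeRatio (k : ℕ) : ℕ := (12 + 4 * k) * 2 ^ k

theorem sizeRatio_pos (k : ℕ) : (0 : ℝ) < sizeRatio k := by
  rw [sizeRatio]; positivity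

theorem alphabetSize_pow_le (hk : 1 ≤ k) (n : ℕ) : alphabetSize k n ^ k ≤ n :=
  (Nat.le_mul_of_pos_left _ (by omega)).trans (mul_alphabetSize_pow_le hk n)

theorem le_sizeRatio_mul_alphabetSize_pow (hk : 1 ≤ k) {n : ℕ} (hn : 12 + 4 * k ≤ n) :
    (n : ℝ) ≤ sizeRatio k * (alphabetSize k n : ℝ) ^ k := by
  have hlt := lt_mul_alphabetSize_succ_pow hk n
  have hpos : 1 ≤ alphabetSize k n := by
    rw [Nat.one_le_iff_ne_zero]
    intro h
    rw [h, zero_add, one_pow] at hlt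
    omega
  have hle : n ≤ sizeRatio k * alphabetSize k n ^ k := calc
    n ≤ (12 + 4 * k) * (alphabetSize k n + 1) ^ k := hlt.le
    _ ≤ (12 + 4 * k) * (2 * alphabetSize k n) ^ k := by gcongr; omega
    _ = sizeRatio k * alphabetSize k n ^ k := by rw [mul_pow, sizeRatio, mul_assoc]
  exact_mod_cast hle

theorem alphabetSize_le_rpow (hk : 1 ≤ k) (n : ℕ) :
    (alphabetSize k n : ℝ) ≤ (n : ℝ) ^ (1 / (k : ℝ)) := by
  have hle : (alphabetSize k n : ℝ) ^ k ≤ n := by exact_mod_cast alphabetSize_pow_le hk n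
  have hroot := Real.rpow_le_rpow (by positivity) hle (show (0 : ℝ) ≤ 1 / k by positivity)
  rwa [one_div, Real.pow_rpow_inv_natCast (by positivity) (by omega), ← one_div] at hroot

theorem rpow_le_mul_alphabetSize (hk : 1 ≤ k) {n : ℕ} (hn : 12 + 4 * k ≤ n) :
    (n : ℝ) ^ (1 / (k : ℝ)) ≤ (sizeRatio k : ℝ) ^ (1 / (k : ℝ)) * alphabetSize k n := by
  have hroot := Real.rpow_le_rpow (by positivity) (le_sizeRatio_mul_alphabetSize_pow hk hn)
    (show (0 : ℝ) ≤ 1 / k by positivity)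
  rw [Real.mul_rpow (by positivity) (by positivity)] at hroot
  nth_rewrite 3 [one_div] at hroot
  rwa [Real.pow_rpow_inv_natCast (by positivity) (by omega)] at hroot

theorem sq_le_mul_card_words (hk : 1 ≤ k) {n : ℕ} (hn : 12 + 4 * k ≤ n) :
    (n : ℝ) ^ 2 ≤ (sizeRatio k : ℝ) ^ 2 *
      ((alphabetSize k n ^ k * alphabetSize k n ^ k : ℕ) : ℝ) := by
  push_cast
  calc (n : ℝ) ^ 2 ≤ (sizeRatio k * (alphabetSize k n : ℝ) ^ k) ^ 2 := by
        gcongr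
        exact le_sizeRatio_mul_alphabetSize_pow hk hn
    _ = _ := by ring

theorem isTheta_card_words (hk : 1 ≤ k) :
    (fun n => ((alphabetSize k n ^ k * alphabetSize k n ^ k : ℕ) : ℝ)) =Θ[atTop]
      (fun n : ℕ => (n : ℝ) ^ 2) := by
  constructor
  · refine IsBigO.of_bound 1 (Eventually.of_forall fun n => ?_)
    rw [Real.norm_of_nonneg (by positivity), Real.norm_of_nonneg (by positivity), one_mul, sq]
    exact_mod_cast Nat.mul_le_mul (alphabetSize_pow_le hk n) (alphabetSize_pow_le hk n)
  · refine IsBigO.of_bound ((sizeRatio k : ℝ) ^ 2) ?_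
    filter_upwards [eventually_ge_atTop (12 + 4 * k)] with n hn
    rw [Real.norm_of_nonneg (by positivity), Real.norm_of_nonneg (by positivity)]
    exact sq_le_mul_card_words hk hn

theorem isTheta_cutSize (hk : 1 ≤ k) :
    (fun n => ((2 * (k * alphabetSize k n) : ℕ) : ℝ)) =Θ[atTop]
      (fun n : ℕ => (n : ℝ) ^ (1 / (k : ℝ))) := by
  constructor
  · refine IsBigO.of_bound (2 * k) (Eventually.of_forall fun n => ?_)
    rw [Real.norm_of_nonneg (by positivity), Real.norm_of_nonneg (by positivity)]
    push_cast
    rw [← mul_assoc]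
    exact mul_le_mul_of_nonneg_left (alphabetSize_le_rpow hk n) (by positivity)
  · refine IsBigO.of_bound ((sizeRatio k : ℝ) ^ (1 / (k : ℝ))) ?_
    filter_upwards [eventually_ge_atTop (12 + 4 * k)] with n hn
    rw [Real.norm_of_nonneg (by positivity), Real.norm_of_nonneg (by positivity)]
    have hle : alphabetSize k n ≤ 2 * (k * alphabetSize k n) :=
      (Nat.le_mul_of_pos_left _ hk).trans (Nat.le_mul_of_pos_left _ two_pos)
    calc (n : ℝ) ^ (1 / (k : ℝ)) ≤ (sizeRatio k : ℝ) ^ (1 / (k : ℝ)) * alphabetSize k n :=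
          rpow_le_mul_alphabetSize hk hn
      _ ≤ (sizeRatio k : ℝ) ^ (1 / (k : ℝ)) * (2 * (k * alphabetSize k n) : ℕ) := by gcongr

theorem exists_isLowerBoundFamily (hk : 1 ≤ k) : ∃ (m C : ℕ → ℕ)
    (G : ∀ n : ℕ, (Fin (m n) → Bool) → (Fin (m n) → Bool) → SimpleGraph (Fin n)),
    (fun n => (m n : ℝ)) =Θ[atTop] (fun n : ℕ => (n : ℝ) ^ 2) ∧
    (fun n => (C n : ℝ)) =Θ[atTop] (fun n : ℕ => (n : ℝ) ^ (1 / (k : ℝ))) ∧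
    IsLowerBoundFamily (fun n g => ¬ HasCopy (patternGraph k) n g) m C (fun n => disj (m n)) G ∧
    IsLowerBoundFamily (fun n g => ¬ HasInducedCopy (patternGraph k) n g) m C
      (fun n => disj (m n)) G := by
  choose V₀ V₁ E₀ E₁ S hfam hcut hcopy using fun n =>
    exists_isCutFamily (n := n) hk (mul_alphabetSize_pow_le hk n)
  let m (n : ℕ) : ℕ := alphabetSize k n ^ k * alphabetSize k n ^ k
  let C (n : ℕ) : ℕ := 2 * (k * alphabetSize k n)
  let G (n : ℕ) (x y : Fin (m n) → Bool) : SimpleGraph (Fin n) := E₀ n x ⊔ E₁ n y ⊔ S n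
  have hfamily {P : ∀ n : ℕ, SimpleGraph (Fin n) → Prop}
      (hP : ∀ n x y, P n (G n x y) ↔ ∃ i, x i = true ∧ y i = true) :
      IsLowerBoundFamily (fun n g => ¬ P n g) m C (fun n => disj (m n)) G :=
    ⟨0, fun n _ => ⟨fun x y => (not_congr (hP n x y)).trans decide_eq_true_iff.symm, V₀ n, V₁ n,
      E₀ n, E₁ n, S n, (hfam n).disjoint, (hfam n).cover, (hfam n).left, (hfam n).right,
      (hfam n).cut, hcut n, fun _ _ => rfl⟩⟩
  exact ⟨m, C, G, isTheta_card_words hk, isTheta_cutSize hk, hfamily fun n x y => (hcopy n x y).1,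
    hfamily fun n x y => (hcopy n x y).2⟩

theorem card_words_le_of_randomizedSolvable (hk : 1 ≤ k) {n B T : ℕ}
    {P : SimpleGraph (Fin n) → Prop}
    (hP : P = HasCopy (patternGraph k) n ∨ P = HasInducedCopy (patternGraph k) n)
    (hsol : RandomizedSolvable P B T)
    (hn : 3600 ≤ ((alphabetSize k n ^ k * alphabetSize k n ^ k : ℕ) : ℝ)) :
    ((alphabetSize k n ^ k * alphabetSize k n ^ k : ℕ) : ℝ) ≤
      9216 * k * (n : ℝ) ^ (1 / (k : ℝ)) * (T * B) := by
  obtain ⟨V₀, V₁, E₀, E₁, S, hfam, hcut, hcopy⟩ :=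
    exists_isCutFamily (n := n) hk (mul_alphabetSize_pow_le hk n)
  have hdisj (x y) : P (E₀ x ⊔ E₁ y ⊔ S) ↔ ∃ i, x i = true ∧ y i = true := by
    rcases hP with rfl | rfl
    exacts [(hcopy x y).1, (hcopy x y).2]
  have hsim := hsol.le_of_isCutFamily hfam hdisj
  have hlog3 : Real.log 3 ≤ 2 :=
    (Real.log_le_sub_one_of_pos three_pos).trans (by norm_num)
  have hlog4 : Real.log 4 ≤ 3 :=
    (Real.log_le_sub_one_of_pos four_pos).trans (by norm_num)
  have htraffic : 2 * (S.edgeSet.ncard : ℝ) * (T * B) * Real.log 3 ≤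
      2 * (2 * (k * (n : ℝ) ^ (1 / (k : ℝ)))) * (T * B) * 2 := by
    rw [hcut]
    push_cast
    gcongr
    exact alphabetSize_le_rpow hk n
  linarith

theorem exists_round_lower_bound (hk : 1 ≤ k) :
    ∃ c : ℝ, 0 < c ∧ ∃ n₀ : ℕ, ∀ n ≥ n₀, ∀ B T : ℕ,
      ∀ P : SimpleGraph (Fin n) → Prop,
        P = HasCopy (patternGraph k) n ∨ P = HasInducedCopy (patternGraph k) n →
        DeterministicallySolvable P B T ∨ RandomizedSolvable P B T →
        c * (n : ℝ) ^ (2 - 1 / (k : ℝ)) ≤ (T : ℝ) * (B : ℝ) := by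
  have hratio := sizeRatio_pos k
  have : (0 : ℝ) < k := by exact_mod_cast hk
  refine ⟨1 / (9216 * k * (sizeRatio k : ℝ) ^ 2), by positivity,
    max (12 + 4 * k) (60 * sizeRatio k), fun n hn B T P hP hsol => ?_⟩
  have hwords := sq_le_mul_card_words hk (le_of_max_le_left hn)
  have hlarge : 60 * (sizeRatio k : ℝ) ≤ n := by exact_mod_cast le_of_max_le_right hn
  have hcard : 3600 ≤ ((alphabetSize k n ^ k * alphabetSize k n ^ k : ℕ) : ℝ) := by
    refine le_of_mul_le_mul_left ?_ (pow_pos hratio 2)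
    calc (sizeRatio k : ℝ) ^ 2 * 3600 = (60 * (sizeRatio k : ℝ)) ^ 2 := by ring
      _ ≤ (n : ℝ) ^ 2 := by gcongr
      _ ≤ _ := hwords
  have hcard_le := card_words_le_of_randomizedSolvable hk hP
    (hsol.elim (·.randomizedSolvable) id) hcard
  have hn₀ : (0 : ℝ) < n := lt_of_lt_of_le (by positivity) hlarge
  have hsq : (n : ℝ) ^ (2 : ℝ) = (n : ℝ) ^ 2 := Real.rpow_two _
  rw [Real.rpow_sub hn₀, hsq, one_div, inv_mul_le_iff₀ (by positivity),
    div_le_iff₀ (Real.rpow_pos_of_pos hn₀ _)]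
  calc (n : ℝ) ^ 2
      ≤ (sizeRatio k : ℝ) ^ 2 * (9216 * k * (n : ℝ) ^ (1 / (k : ℝ)) * (T * B)) :=
        hwords.trans (by gcongr)
    _ = _ := by ring

theorem exists_round_lower_bound_log (hk : 1 ≤ k) (β : ℝ) (hβ : 0 < β) :
    ∃ c : ℝ, 0 < c ∧ ∃ n₀ : ℕ, ∀ n ≥ n₀, ∀ B T : ℕ,
      (B : ℝ) ≤ β * Real.log n →
      ∀ P : SimpleGraph (Fin n) → Prop,
        P = HasCopy (patternGraph k) n ∨ P = HasInducedCopy (patternGraph k) n →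
        DeterministicallySolvable P B T ∨ RandomizedSolvable P B T →
        c * (n : ℝ) ^ (2 - 1 / (k : ℝ)) / Real.log n ≤ (T : ℝ) := by
  obtain ⟨c, hc, n₀, hbound⟩ := exists_round_lower_bound hk
  refine ⟨c / β, by positivity, max n₀ 2, fun n hn B T hB P hP hsol => ?_⟩
  have hlog : 0 < Real.log n := Real.log_pos (by exact_mod_cast le_of_max_le_right hn)
  rw [div_le_iff₀ hlog, div_mul_eq_mul_div, div_le_iff₀ hβ]
  calc c * (n : ℝ) ^ (2 - 1 / (k : ℝ)) ≤ T * B := hbound n (le_of_max_le_left hn) B T P hP hsol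
    _ ≤ T * (β * Real.log n) := by gcongr
    _ = T * Real.log n * β := by ring

end Parameters

/-! ### Treewidth -/

section Median

variable {ι : Type*} {G : SimpleGraph ι}

theorem isPath_append_of_inter {u v w : ι} {p : G.Walk u v} {q : G.Walk v w} (hp : p.IsPath)
    (hq : q.IsPath) (h : ∀ x ∈ p.support, x ∈ q.support → x = v) : (p.append q).IsPath := by
  have hnodup := hq.support_nodup
  rw [← q.cons_tail_support, List.nodup_cons] at hnodup
  rw [SimpleGraph.Walk.isPath_def, SimpleGraph.Walk.support_append, List.nodup_append]
  refine ⟨hp.support_nodup, hnodup.2, ?_⟩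
  rintro x hx _ hxq rfl
  exact hnodup.1 (h x hx (List.mem_of_mem_tail hxq) ▸ hxq)

theorem exists_isPath_median (hG : G.Connected) (i j l : ι) :
    ∃ (m : ι) (p : G.Walk i j) (q : G.Walk l i) (r : G.Walk l j), p.IsPath ∧ q.IsPath ∧ r.IsPath ∧
      m ∈ p.support ∧ m ∈ q.support ∧ m ∈ r.support := by
  classical
  obtain ⟨p, hp⟩ := (hG i j).exists_isPath
  obtain ⟨q, hq⟩ := (hG l i).exists_isPath
  obtain ⟨m, hm, hmq, hfirst⟩ := q.exists_mem_support_forall_mem_support_imp_eq p.support.toFinset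
    ⟨i, by simp⟩
  rw [List.mem_toFinset] at hm
  have hmeet (x : ι) (hx : x ∈ (q.takeUntil m hmq).support) (hxp : x ∈ p.support) : x = m :=
    hfirst x (List.mem_toFinset.mpr hxp) hx
  have hlm := hq.takeUntil hmq
  refine ⟨m, p, (q.takeUntil m hmq).append (p.takeUntil m hm).reverse,
    (q.takeUntil m hmq).append (p.dropUntil m hm), hp,
    isPath_append_of_inter hlm (hp.takeUntil hm).reverse fun x hx hxp => hmeet x hx ?_,
    isPath_append_of_inter hlm (hp.dropUntil hm) fun x hx hxp => hmeet x hx ?_, hm,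
    SimpleGraph.Walk.support_subset_support_append_left _ _ (SimpleGraph.Walk.end_mem_support _),
    SimpleGraph.Walk.support_subset_support_append_left _ _ (SimpleGraph.Walk.end_mem_support _)⟩
  · rw [SimpleGraph.Walk.support_reverse, List.mem_reverse] at hxp
    exact p.support_takeUntil_subset_support hm hxp
  · exact p.support_dropUntil_subset_support hm hxp

end Median

theorem two_le_width_of_triangle {V : Type*} {G : SimpleGraph V} {ι : Type} [Fintype ι]
    (D : G.TreeDecomposition ι) {a b c : V} (hab : G.Adj a b) (hbc : G.Adj b c)
    (hac : G.Adj a c) : 2 ≤ D.width := by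
  classical
  obtain ⟨i, hia, hib⟩ := D.edge_mem a b hab
  obtain ⟨j, hjb, hjc⟩ := D.edge_mem b c hbc
  obtain ⟨l, hla, hlc⟩ := D.edge_mem a c hac
  obtain ⟨m, p, q, r, hp, hq, hr, hmp, hmq, hmr⟩ := exists_isPath_median D.isTree.connected i j l
  have ha : a ∈ D.bag m := D.path_mem l i q hq m hmq a hla hia
  have hb : b ∈ D.bag m := D.path_mem i j p hp m hmp b hib hjb
  have hc : c ∈ D.bag m := D.path_mem l j r hr m hmr c hlc hjc
  have hcard : ({a, b, c} : Finset V).card = 3 :=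
    Finset.card_eq_three.mpr ⟨a, b, c, hab.ne, hac.ne, hbc.ne, rfl⟩
  have hsub : ({a, b, c} : Finset V) ⊆ D.bag m := by
    simp only [Finset.insert_subset_iff, Finset.singleton_subset_iff]
    exact ⟨ha, hb, hc⟩
  have hsup : (D.bag m).card ≤ Finset.univ.sup fun i => (D.bag i).card :=
    Finset.le_sup (f := fun i => (D.bag i).card) (Finset.mem_univ m)
  have := Finset.card_le_card hsub
  rw [SimpleGraph.TreeDecomposition.width]
  omega

section ParentTree

variable {ι : Type*} {parent : ι → ι} {root : ι} {depth : ι → ℕ}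

/-- The graph in which every node other than the root is joined to its parent. It is a tree if the
nodes have depths that decrease from each node to its parent. -/
def parentTree (parent : ι → ι) (root : ι) : SimpleGraph ι :=
  .fromRel fun i j => i ≠ root ∧ parent i = j

theorem parentTree_adj_parent (hdepth : ∀ i ≠ root, depth (parent i) < depth i) {i : ι}
    (hi : i ≠ root) : (parentTree parent root).Adj i (parent i) := by
  rw [parentTree, SimpleGraph.fromRel_adj]
  exact ⟨fun h => (hdepth i hi).ne (congrArg depth h.symm), .inl ⟨hi, rfl⟩⟩

theorem exists_walk_parentTree (hdepth : ∀ i ≠ root, depth (parent i) < depth i) (S : Set ι)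
    (top : ι) (hS : ∀ i ∈ S, i = top ∨ (i ≠ root ∧ parent i ∈ S)) (i : ι) (hi : i ∈ S) :
    ∃ p : (parentTree parent root).Walk i top, ∀ x ∈ p.support, x ∈ S := by
  induction hd : depth i using Nat.strong_induction_on generalizing i with
  | _ d ih =>
    rcases hS i hi with rfl | ⟨hroot, hparent⟩
    · exact ⟨.nil, by simpa using hi⟩
    · obtain ⟨p, hp⟩ := ih _ (hd ▸ hdepth i hroot) (parent i) hparent rfl
      refine ⟨.cons (parentTree_adj_parent hdepth hroot) p, ?_⟩
      simpa using ⟨hi, hp⟩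

theorem connected_parentTree (hdepth : ∀ i ≠ root, depth (parent i) < depth i) :
    (parentTree parent root).Connected := by
  have hreachable (i : ι) : (parentTree parent root).Reachable i root := by
    obtain ⟨p, -⟩ := exists_walk_parentTree hdepth Set.univ root
      (fun j _ => (eq_or_ne j root).imp_right fun h => ⟨h, trivial⟩) i trivial
    exact p.reachable
  exact (SimpleGraph.connected_iff _).mpr
    ⟨fun i j => (hreachable i).trans (hreachable j).symm, ⟨root⟩⟩

theorem ncard_edgeSet_parentTree_lt [Finite ι] (parent : ι → ι) (root : ι) :
    (parentTree parent root).edgeSet.ncard < Nat.card ι := by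
  have hsub : (parentTree parent root).edgeSet ⊆ (fun i => s(i, parent i)) '' {root}ᶜ := by
    intro e he
    induction e with | _ x y
    rw [SimpleGraph.mem_edgeSet, parentTree, SimpleGraph.fromRel_adj] at he
    rcases he.2 with ⟨h, rfl⟩ | ⟨h, rfl⟩
    · exact ⟨x, h, rfl⟩
    · exact ⟨y, h, Sym2.eq_swap⟩
  calc (parentTree parent root).edgeSet.ncard
      ≤ ((fun i => s(i, parent i)) '' {root}ᶜ).ncard := Set.ncard_le_ncard hsub (Set.toFinite _)
    _ ≤ ({root}ᶜ : Set ι).ncard := Set.ncard_image_le (Set.toFinite _)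
    _ < (Set.univ : Set ι).ncard :=
      Set.ncard_lt_ncard (Set.ssubset_univ_iff.mpr (by simp)) (Set.toFinite _)
    _ = Nat.card ι := Set.ncard_univ ι

theorem isTree_parentTree [Finite ι] (hdepth : ∀ i ≠ root, depth (parent i) < depth i) :
    (parentTree parent root).IsTree := by
  have hconn := connected_parentTree hdepth
  rw [SimpleGraph.isTree_iff_connected_and_card, Nat.card_coe_set_eq]
  refine ⟨hconn, le_antisymm (ncard_edgeSet_parentTree_lt parent root) ?_⟩
  exact hconn.card_vert_le_card_edgeSet_add_one

end ParentTree

/-- The tree decomposition given by a parent function and bags such that every vertex has a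
topmost bag: whenever another bag contains the vertex, so does its parent. -/
def treeDecompositionOfParent {V : Type*} {G : SimpleGraph V} {ι : Type} [Finite ι]
    {parent : ι → ι} {root : ι} {depth : ι → ℕ}
    (hdepth : ∀ i ≠ root, depth (parent i) < depth i)
    (bag : ι → Finset V) (vertex_mem : ∀ v : V, ∃ i, v ∈ bag i)
    (edge_mem : ∀ u v : V, G.Adj u v → ∃ i, u ∈ bag i ∧ v ∈ bag i)
    (htop : ∀ v, ∃ top, ∀ i, v ∈ bag i → i = top ∨ (i ≠ root ∧ v ∈ bag (parent i))) :
    G.TreeDecomposition ι where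
  tree := parentTree parent root
  isTree := isTree_parentTree hdepth
  bag := bag
  vertex_mem := vertex_mem
  edge_mem := edge_mem
  path_mem := by
    classical
    intro i l p hp j hj v hi hl
    obtain ⟨top, htop⟩ := htop v
    obtain ⟨q, hq⟩ := exists_walk_parentTree hdepth {i | v ∈ bag i} top htop i hi
    obtain ⟨r, hr⟩ := exists_walk_parentTree hdepth {i | v ∈ bag i} top htop l hl
    have hunique : p = (q.append r.reverse).bypass :=
      ((isTree_parentTree hdepth).existsUnique_path i l).unique hp
        (SimpleGraph.Walk.bypass_isPath _)
    rw [hunique] at hj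
    have hmem := SimpleGraph.Walk.support_bypass_subset_support _ hj
    rw [SimpleGraph.Walk.mem_support_append_iff, SimpleGraph.Walk.support_reverse,
      List.mem_reverse] at hmem
    exact hmem.elim (hq j) (hr j)

namespace patternGraph

variable {k : ℕ}

/-- Nodes of the tree of a tree decomposition of the pattern: a path of six nodes that triangulates
the cycle through the four triangles, a node for each triangle, and two nodes for each path of
length three. -/
abbrev BagIndex (k : ℕ) : Type := Fin 6 ⊕ (Fin 2 × Fin 2) ⊕ (Fin 2 × Fin k) ⊕ (Fin 2 × Fin k)

/-- The parent function of the tree decomposition. Its root is `Sum.inl 0`. -/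
def bagParent : BagIndex k → BagIndex k
  | .inl j => .inl (![0, 0, 1, 2, 3, 4] j)
  | .inr (.inl (a, i)) =>
    .inl (if i = 0 then (if a = 0 then 0 else 1) else (if a = 0 then 5 else 3))
  | .inr (.inr (.inl (i, _))) => .inl (if i = 0 then 0 else 4)
  | .inr (.inr (.inr (i, p))) => .inr (.inr (.inl (i, p)))

/-- A measure that decreases from a node to its parent. -/
def bagDepth : BagIndex k → ℕ
  | .inl j => j
  | .inr (.inl _) => 10
  | .inr (.inr (.inl _)) => 10
  | .inr (.inr (.inr _)) => 11

/-- The bags of the tree decomposition, each of at most three nodes. The cycle through the four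
triangles is
`(0, 0, 0), (0, 0, 1), (1, 0, 1), (1, 0, 0), (1, 1, 0), (1, 1, 1), (0, 1, 1), (0, 1, 0)`.
Its second and sixth edges stand for the `k` paths between two triangles. -/
def bag : BagIndex k → Finset (PatternVertex k)
  | .inl j =>
      {.inl (0, 0, 0),
        (![.inl (0, 0, 1), .inl (1, 0, 1), .inl (1, 0, 0), .inl (1, 1, 0), .inl (1, 1, 1),
          .inl (0, 1, 1)] : Fin 6 → PatternVertex k) j,
        (![.inl (1, 0, 1), .inl (1, 0, 0), .inl (1, 1, 0), .inl (1, 1, 1), .inl (0, 1, 1),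
          .inl (0, 1, 0)] : Fin 6 → PatternVertex k) j}
  | .inr (.inl (a, i)) => {.inl (a, i, 0), .inl (a, i, 1), .inl (a, i, 2)}
  | .inr (.inr (.inl (i, p))) => {.inl (0, i, 1), .inl (1, i, 1), .inr (0, i, p)}
  | .inr (.inr (.inr (i, p))) => {.inl (1, i, 1), .inr (0, i, p), .inr (1, i, p)}

/-- The topmost bag that contains a given vertex. -/
def topBag : PatternVertex k → BagIndex k
  | .inl (a, i, l) => if l = 2 then .inr (.inl (a, i)) else
      .inl (if i = 0 then (if l = 0 ∧ a = 1 then 1 else 0) else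
        (if l = 0 then (if a = 0 then 5 else 2) else (if a = 0 then 4 else 3)))
  | .inr (a, i, p) => if a = 0 then .inr (.inr (.inl (i, p))) else .inr (.inr (.inr (i, p)))

theorem bagDepth_bagParent_lt (i : BagIndex k) (hi : i ≠ .inl 0) :
    bagDepth (bagParent i) < bagDepth i := by
  rcases i with j | ⟨a, i⟩ | ⟨i, p⟩ | ⟨i, p⟩
  · fin_cases j <;> simp [bagDepth, bagParent] at hi ⊢
  · fin_cases a <;> fin_cases i <;> simp [bagDepth, bagParent]
  · fin_cases i <;> simp [bagDepth, bagParent]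
  · simp [bagDepth, bagParent]

theorem eq_topBag_or_mem_bag_bagParent (v : PatternVertex k) (i : BagIndex k) (hv : v ∈ bag i) :
    i = topBag v ∨ (i ≠ .inl 0 ∧ v ∈ bag (bagParent i)) := by
  rcases i with j | ⟨a, i⟩ | ⟨i, p⟩ | ⟨i, p⟩ <;>
    simp only [bag, Finset.mem_insert, Finset.mem_singleton] at hv
  · fin_cases j <;> rcases hv with rfl | rfl | rfl <;> simp [topBag, bag, bagParent]
  · fin_cases a <;> fin_cases i <;> rcases hv with rfl | rfl | rfl <;>
      simp [topBag, bag, bagParent]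
  · fin_cases i <;> rcases hv with rfl | rfl | rfl <;> simp [topBag, bag, bagParent]
  · rcases hv with rfl | rfl | rfl <;> simp [topBag, bag, bagParent]

theorem exists_mem_bag_of_adj (u v : PatternVertex k) (h : (patternGraph k).Adj u v) :
    ∃ i, u ∈ bag i ∧ v ∈ bag i := by
  have hinner (a i : Fin 2) (p : Fin k) :
      ∃ j, .inl (a, i, 1) ∈ bag (k := k) j ∧ .inr (a, i, p) ∈ bag j := by
    fin_cases a
    · exact ⟨.inr (.inr (.inl (i, p))), by simp [bag]⟩
    · exact ⟨.inr (.inr (.inr (i, p))), by simp [bag]⟩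
  rcases u with ⟨a, i, l⟩ | ⟨a, i, p⟩ <;> rcases v with ⟨a', i', l'⟩ | ⟨a', i', p'⟩ <;>
    simp only [patternGraph] at h
  · obtain ⟨rfl, ⟨rfl, -⟩ | ⟨hi, rfl, rfl⟩⟩ := h
    · exact ⟨.inr (.inl (a, i)), by fin_cases l <;> simp [bag], by fin_cases l' <;> simp [bag]⟩
    · refine ⟨.inl (if a = 0 then 5 else 2), ?_⟩
      fin_cases a <;> fin_cases i <;> fin_cases i' <;> simp [bag] at hi ⊢
  · obtain ⟨rfl, rfl, rfl⟩ := h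
    exact hinner a i p'
  · obtain ⟨rfl, rfl, rfl⟩ := h
    exact (hinner a i p).imp fun _ => And.symm
  · obtain ⟨ha, rfl, rfl⟩ := h
    refine ⟨.inr (.inr (.inr (i, p))), ?_⟩
    fin_cases a <;> fin_cases a' <;> simp [bag] at ha ⊢

/-- A tree decomposition of the pattern of width two. -/
def treeDecomposition (k : ℕ) : (patternGraph k).TreeDecomposition (BagIndex k) :=
  treeDecompositionOfParent bagDepth_bagParent_lt bag
    (fun v => (exists_adj v).elim fun w h => (exists_mem_bag_of_adj v w h).imp fun _ => And.left)
    exists_mem_bag_of_adj fun v => ⟨topBag v, eq_topBag_or_mem_bag_bagParent v⟩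

theorem width_treeDecomposition_le (k : ℕ) : (treeDecomposition k).width ≤ 2 := by
  rw [SimpleGraph.TreeDecomposition.width, Nat.sub_le_iff_le_add, Finset.sup_le_iff]
  rintro (j | ⟨a, i⟩ | ⟨i, p⟩ | ⟨i, p⟩) - <;> exact Finset.card_le_three

theorem treewidth_eq_two (k : ℕ) : (patternGraph k).treewidth = 2 := by
  have hlower {ι : Type} [Fintype ι] (D : (patternGraph k).TreeDecomposition ι) : 2 ≤ D.width :=
    two_le_width_of_triangle D (a := .inl (0, 0, 0)) (b := .inl (0, 0, 1)) (c := .inl (0, 0, 2))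
      ⟨rfl, .inl ⟨rfl, by decide⟩⟩ ⟨rfl, .inl ⟨rfl, by decide⟩⟩ ⟨rfl, .inl ⟨rfl, by decide⟩⟩
  have hmem : 2 ∈ {w | ∃ (ι : Type) (_ : Fintype ι)
      (D : (patternGraph k).TreeDecomposition ι), D.width = w} :=
    ⟨BagIndex k, inferInstance, treeDecomposition k,
      le_antisymm (width_treeDecomposition_le k) (hlower _)⟩
  refine le_antisymm (Nat.sInf_le hmem) (le_csInf ⟨2, hmem⟩ ?_)
  rintro w ⟨ι, _, D, rfl⟩
  exact hlower D

end patternGraph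

/-! ### Series-parallel graphs -/

section SeriesParallel

variable {V : Type*} {G : SimpleGraph V}

theorem isTwoTerminalSP_symm {S : G.Subgraph} {s t : V} (h : SimpleGraph.IsTwoTerminalSP S s t) :
    SimpleGraph.IsTwoTerminalSP S t s := by
  induction h with
  | edge h => exact SimpleGraph.subgraphOfAdj_symm h ▸ .edge h.symm
  | series _ _ hinter ih₁ ih₂ =>
    rw [sup_comm]
    exact ih₂.series ih₁ ((Set.inter_comm _ _).trans hinter)
  | parallel _ _ hinter ih₁ ih₂ => exact ih₁.parallel ih₂ (hinter.trans (Set.pair_comm _ _))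

theorem isTwoTerminalSP_induce_triangle {a b c : V} (hab : G.Adj a b) (hac : G.Adj a c)
    (hcb : G.Adj c b) :
    SimpleGraph.IsTwoTerminalSP ((⊤ : G.Subgraph).induce {a, b, c}) a b := by
  have := hab.ne
  have := hac.ne
  have := hcb.ne
  have hsup : (⊤ : G.Subgraph).induce {a, b, c} =
      G.subgraphOfAdj hab ⊔ (G.subgraphOfAdj hac ⊔ G.subgraphOfAdj hcb) := by
    ext x y
    · simp only [SimpleGraph.Subgraph.induce_verts, SimpleGraph.Subgraph.verts_sup,
        SimpleGraph.subgraphOfAdj_verts, Set.mem_union, Set.mem_insert_iff, Set.mem_singleton_iff]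
      tauto
    · simp only [SimpleGraph.Subgraph.induce_adj, SimpleGraph.Subgraph.top_adj,
        SimpleGraph.Subgraph.sup_adj, SimpleGraph.subgraphOfAdj_adj, Set.mem_insert_iff,
        Set.mem_singleton_iff, Sym2.eq_iff]
      grind [G.adj_comm, G.irrefl]
  rw [hsup]
  refine .parallel (.edge hab) (.series (.edge hac) (.edge hcb) ?_) ?_
  all_goals
    ext
    simp only [SimpleGraph.Subgraph.verts_sup, SimpleGraph.subgraphOfAdj_verts, Set.mem_inter_iff,
      Set.mem_union, Set.mem_insert_iff, Set.mem_singleton_iff]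
    grind

theorem isTwoTerminalSP_induce_path {a x y b : V} (hax : G.Adj a x) (hxy : G.Adj x y)
    (hyb : G.Adj y b) (hab : a ≠ b) (hay : ¬ G.Adj a y) (hxb : ¬ G.Adj x b) (hab' : ¬ G.Adj a b) :
    SimpleGraph.IsTwoTerminalSP ((⊤ : G.Subgraph).induce {a, x, y, b}) a b := by
  have := hax.ne
  have := hxy.ne
  have := hyb.ne
  have hay' : a ≠ y := by
    rintro rfl
    exact hab' hyb
  have hxb' : x ≠ b := by
    rintro rfl
    exact hab' hax
  have hsup : (⊤ : G.Subgraph).induce {a, x, y, b} =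
      G.subgraphOfAdj hax ⊔ (G.subgraphOfAdj hxy ⊔ G.subgraphOfAdj hyb) := by
    ext u v
    · simp only [SimpleGraph.Subgraph.induce_verts, SimpleGraph.Subgraph.verts_sup,
        SimpleGraph.subgraphOfAdj_verts, Set.mem_union, Set.mem_insert_iff, Set.mem_singleton_iff]
      tauto
    · simp only [SimpleGraph.Subgraph.induce_adj, SimpleGraph.Subgraph.top_adj,
        SimpleGraph.Subgraph.sup_adj, SimpleGraph.subgraphOfAdj_adj, Set.mem_insert_iff,
        Set.mem_singleton_iff, Sym2.eq_iff]
      grind [G.adj_comm, G.irrefl]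
  rw [hsup]
  refine .series (.edge hax) (.series (.edge hxy) (.edge hyb) ?_) ?_
  all_goals
    ext
    simp only [SimpleGraph.Subgraph.verts_sup, SimpleGraph.subgraphOfAdj_verts, Set.mem_inter_iff,
      Set.mem_union, Set.mem_insert_iff, Set.mem_singleton_iff]
    grind

theorem isTwoTerminalSP_iSup {κ : Type*} [Finite κ] [Nonempty κ] {S : κ → G.Subgraph} {s t : V}
    (hS : ∀ p, SimpleGraph.IsTwoTerminalSP (S p) s t)
    (hinter : Pairwise fun p q => (S p).verts ∩ (S q).verts = {s, t}) :
    SimpleGraph.IsTwoTerminalSP (⨆ p, S p) s t := by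
  have := Fintype.ofFinite κ
  suffices h : ∀ F : Finset κ, F.Nonempty → SimpleGraph.IsTwoTerminalSP (⨆ p ∈ F, S p) s t by
    simpa using h Finset.univ Finset.univ_nonempty
  intro F hF
  induction hF using Finset.Nonempty.cons_induction with
  | singleton p => simpa using hS p
  | cons p F hp hF ih =>
    have hmeet (q : κ) (hq : q ∈ F) : (S p).verts ∩ (S q).verts = {s, t} :=
      hinter (ne_of_mem_of_not_mem hq hp).symm
    have hcons : ⨆ q ∈ Finset.cons p F hp, S q = S p ⊔ ⨆ q ∈ F, S q := by
      simp only [Finset.mem_cons, iSup_or, iSup_sup_eq, iSup_iSup_eq_left]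
    rw [hcons]
    refine (hS p).parallel ih ?_
    simp only [SimpleGraph.Subgraph.verts_iSup, Set.inter_iUnion₂]
    rw [Set.iUnion₂_congr hmeet]
    exact Set.biUnion_const hF _

end SeriesParallel

namespace patternGraph

variable {k : ℕ}

/-- The triangle number `i` on side `a`. -/
def triangle (a i : Fin 2) : (patternGraph k).Subgraph :=
  (⊤ : (patternGraph k).Subgraph).induce {.inl (a, i, 0), .inl (a, i, 1), .inl (a, i, 2)}

/-- The `p`-th path of length three between the two triangles number `i`. -/
def path (i : Fin 2) (p : Fin k) : (patternGraph k).Subgraph :=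
  (⊤ : (patternGraph k).Subgraph).induce
    {.inl (0, i, 1), .inr (0, i, p), .inr (1, i, p), .inl (1, i, 1)}

theorem adj_triangle (a i : Fin 2) {l l' : Fin 3} (h : l ≠ l') :
    (patternGraph k).Adj (.inl (a, i, l)) (.inl (a, i, l')) := ⟨rfl, .inl ⟨rfl, h⟩⟩

theorem adj_bridge (a : Fin 2) : (patternGraph k).Adj (.inl (a, 0, 0)) (.inl (a, 1, 0)) :=
  ⟨rfl, .inr ⟨by decide, rfl, rfl⟩⟩

/-- The edge between the two triangles on side `a`. -/
def bridge (a : Fin 2) : (patternGraph k).Subgraph := (patternGraph k).subgraphOfAdj (adj_bridge a)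

theorem isTwoTerminalSP_triangle (a i : Fin 2) :
    SimpleGraph.IsTwoTerminalSP (triangle (k := k) a i) (.inl (a, i, 0)) (.inl (a, i, 1)) :=
  isTwoTerminalSP_induce_triangle (adj_triangle a i (by decide)) (adj_triangle a i (by decide))
    (adj_triangle a i (by decide))

theorem isTwoTerminalSP_path (i : Fin 2) (p : Fin k) :
    SimpleGraph.IsTwoTerminalSP (path i p) (.inl (0, i, 1)) (.inl (1, i, 1)) := by
  apply isTwoTerminalSP_induce_path <;> simp [patternGraph]

theorem isTwoTerminalSP_iSup_path (hk : 1 ≤ k) (i : Fin 2) :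
    SimpleGraph.IsTwoTerminalSP (⨆ p : Fin k, path i p) (.inl (0, i, 1)) (.inl (1, i, 1)) := by
  have : Nonempty (Fin k) := ⟨⟨0, hk⟩⟩
  refine isTwoTerminalSP_iSup (isTwoTerminalSP_path i) fun p q hpq => ?_
  ext w
  simp only [path, SimpleGraph.Subgraph.induce_verts, Set.mem_inter_iff, Set.mem_insert_iff,
    Set.mem_singleton_iff]
  grind

theorem mem_verts_triangle {a i : Fin 2} {w : PatternVertex k} :
    w ∈ (triangle a i).verts ↔ ∃ l, w = .inl (a, i, l) := by
  simp [triangle, Fin.exists_fin_succ]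

theorem mem_verts_iSup_path (hk : 1 ≤ k) {i : Fin 2} {w : PatternVertex k} :
    w ∈ (⨆ p : Fin k, path i p).verts ↔ (∃ a, w = .inl (a, i, 1)) ∨ ∃ a p, w = .inr (a, i, p) := by
  have : Nonempty (Fin k) := ⟨⟨0, hk⟩⟩
  simp only [path, SimpleGraph.Subgraph.verts_iSup, SimpleGraph.Subgraph.induce_verts,
    Set.mem_iUnion, Set.mem_insert_iff, Set.mem_singleton_iff, exists_or, exists_const,
    Fin.exists_fin_two]
  tauto

theorem triangle_adj (a i : Fin 2) {l l' : Fin 3} (h : l ≠ l') :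
    (triangle (k := k) a i).Adj (.inl (a, i, l)) (.inl (a, i, l')) :=
  ⟨by fin_cases l <;> simp, by fin_cases l' <;> simp, adj_triangle (k := k) a i h⟩

theorem path_adj_inl_inr (a i : Fin 2) (p : Fin k) :
    (path i p).Adj (.inl (a, i, 1)) (.inr (a, i, p)) :=
  ⟨by fin_cases a <;> simp, by fin_cases a <;> simp, rfl, rfl, rfl⟩

theorem path_adj_inr_inr {a a' : Fin 2} (h : a ≠ a') (i : Fin 2) (p : Fin k) :
    (path i p).Adj (.inr (a, i, p)) (.inr (a', i, p)) :=
  ⟨by fin_cases a <;> simp, by fin_cases a' <;> simp, h, rfl, rfl⟩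

theorem sup_eq_top (hk : 1 ≤ k) :
    bridge 0 ⊔ (triangle 0 0 ⊔ ((⨆ p, path 0 p) ⊔ (triangle 1 0 ⊔ (bridge 1 ⊔ (triangle 1 1 ⊔
      ((⨆ p, path 1 p) ⊔ triangle 0 1)))))) = (⊤ : (patternGraph k).Subgraph) := by
  refine SimpleGraph.Subgraph.ext (Set.eq_univ_of_forall fun w => ?_) ?_
  · simp only [SimpleGraph.Subgraph.verts_sup, Set.mem_union, mem_verts_triangle,
      mem_verts_iSup_path hk]
    rcases w with ⟨a, i, l⟩ | ⟨a, i, p⟩ <;> fin_cases a <;> fin_cases i <;> simp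
  · funext u v
    refine propext ⟨fun h => SimpleGraph.Subgraph.adj_sub _ h, fun h => ?_⟩
    rw [SimpleGraph.Subgraph.top_adj] at h
    simp only [SimpleGraph.Subgraph.sup_adj, SimpleGraph.Subgraph.iSup_adj]
    rcases u with ⟨a, i, l⟩ | ⟨a, i, p⟩ <;> rcases v with ⟨a', i', l'⟩ | ⟨a', i', p'⟩ <;>
        simp only [patternGraph] at h
    · obtain ⟨rfl, ⟨rfl, h⟩ | ⟨hi, rfl, rfl⟩⟩ := h
      · have := triangle_adj (k := k) a i h
        fin_cases a <;> fin_cases i <;> tauto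
      · fin_cases a <;> fin_cases i <;> fin_cases i' <;> simp [bridge] at hi ⊢
    · obtain ⟨rfl, rfl, rfl⟩ := h
      have : ∃ q, (path i q).Adj (.inl (a, i, 1)) (.inr (a, i, p')) := ⟨p', path_adj_inl_inr a i p'⟩
      fin_cases i <;> tauto
    · obtain ⟨rfl, rfl, rfl⟩ := h
      have : ∃ q, (path i q).Adj (.inr (a, i, p)) (.inl (a, i, 1)) :=
        ⟨p, (path_adj_inl_inr a i p).symm⟩
      fin_cases i <;> tauto
    · obtain ⟨h, rfl, rfl⟩ := h
      have : ∃ q, (path i q).Adj (.inr (a, i, p)) (.inr (a', i, p)) := ⟨p, path_adj_inr_inr h i p⟩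
      fin_cases i <;> tauto

theorem isSeriesParallel (hk : 1 ≤ k) : (patternGraph k).IsSeriesParallel := by
  have hbridge (a : Fin 2) : SimpleGraph.IsTwoTerminalSP (bridge (k := k) a)
    (.inl (a, 0, 0)) (.inl (a, 1, 0)) := .edge _
  refine ⟨_, _, sup_eq_top hk ▸ (hbridge 0).parallel ((isTwoTerminalSP_triangle 0 0).series
    ((isTwoTerminalSP_iSup_path hk 0).series
      ((isTwoTerminalSP_symm (isTwoTerminalSP_triangle 1 0)).series
        ((hbridge 1).series ((isTwoTerminalSP_triangle 1 1).series
          ((isTwoTerminalSP_symm (isTwoTerminalSP_iSup_path hk 1)).series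
            (isTwoTerminalSP_symm (isTwoTerminalSP_triangle 0 1)) ?_) ?_) ?_) ?_) ?_) ?_) ?_⟩
  all_goals
    ext w
    simp only [SimpleGraph.Subgraph.verts_sup, Set.mem_inter_iff, Set.mem_union, mem_verts_triangle,
      mem_verts_iSup_path hk, bridge, SimpleGraph.subgraphOfAdj_verts, Set.mem_insert_iff,
      Set.mem_singleton_iff]
    rcases w with ⟨a, i, l⟩ | ⟨a, i, p⟩ <;> fin_cases a <;> fin_cases i <;> simp

end patternGraph

theorem mainTheorem2_general (k : ℕ) (hk : 1 ≤ k) :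
    (patternGraph k).IsSeriesParallel ∧
    (patternGraph k).treewidth = 2 ∧
    (∃ (m C : ℕ → ℕ)
        (G : ∀ n : ℕ, (Fin (m n) → Bool) → (Fin (m n) → Bool) → SimpleGraph (Fin n)),
      (fun n => (m n : ℝ)) =Θ[atTop] (fun n : ℕ => (n : ℝ) ^ 2) ∧
      (fun n => (C n : ℝ)) =Θ[atTop] (fun n : ℕ => (n : ℝ) ^ (1 / (k : ℝ))) ∧
      IsLowerBoundFamily (fun n g => ¬ HasCopy (patternGraph k) n g) m C
        (fun n => disj (m n)) G ∧
      IsLowerBoundFamily (fun n g => ¬ HasInducedCopy (patternGraph k) n g) m C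
        (fun n => disj (m n)) G) ∧
    (∃ c : ℝ, 0 < c ∧ ∃ n₀ : ℕ, ∀ n ≥ n₀, ∀ B T : ℕ,
      ∀ P : SimpleGraph (Fin n) → Prop,
        P = HasCopy (patternGraph k) n ∨ P = HasInducedCopy (patternGraph k) n →
        DeterministicallySolvable P B T ∨ RandomizedSolvable P B T →
        c * (n : ℝ) ^ (2 - 1 / (k : ℝ)) ≤ (T : ℝ) * (B : ℝ)) ∧
    (∀ β : ℝ, 0 < β → ∃ c : ℝ, 0 < c ∧ ∃ n₀ : ℕ, ∀ n ≥ n₀, ∀ B T : ℕ,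
      (B : ℝ) ≤ β * Real.log n →
      ∀ P : SimpleGraph (Fin n) → Prop,
        P = HasCopy (patternGraph k) n ∨ P = HasInducedCopy (patternGraph k) n →
        DeterministicallySolvable P B T ∨ RandomizedSolvable P B T →
        c * (n : ℝ) ^ (2 - 1 / (k : ℝ)) / Real.log n ≤ (T : ℝ)) :=
  ⟨patternGraph.isSeriesParallel hk, patternGraph.treewidth_eq_two k, exists_isLowerBoundFamily hk,
    exists_round_lower_bound hk, exists_round_lower_bound_log hk⟩

theorem mainTheorem2 (k : ℕ) (hk : 2 ≤ k) :
    (patternGraph k).IsSeriesParallel ∧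
    (patternGraph k).treewidth = 2 ∧
    -- a family of lower bound graphs for detection and for induced detection
    (∃ (m C : ℕ → ℕ)
        (G : ∀ n : ℕ, (Fin (m n) → Bool) → (Fin (m n) → Bool) → SimpleGraph (Fin n)),
      (fun n => (m n : ℝ)) =Θ[atTop] (fun n : ℕ => (n : ℝ) ^ 2) ∧
      (fun n => (C n : ℝ)) =Θ[atTop] (fun n : ℕ => (n : ℝ) ^ (1 / (k : ℝ))) ∧
      IsLowerBoundFamily (fun n g => ¬ HasCopy (patternGraph k) n g) m C
        (fun n => disj (m n)) G ∧
      IsLowerBoundFamily (fun n g => ¬ HasInducedCopy (patternGraph k) n g) m C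
        (fun n => disj (m n)) G) ∧
    -- round lower bound with arbitrary bandwidth `B`
    (∃ c : ℝ, 0 < c ∧ ∃ n₀ : ℕ, ∀ n ≥ n₀, ∀ B T : ℕ,
      ∀ P : SimpleGraph (Fin n) → Prop,
        P = HasCopy (patternGraph k) n ∨ P = HasInducedCopy (patternGraph k) n →
        DeterministicallySolvable P B T ∨ RandomizedSolvable P B T →
        c * (n : ℝ) ^ (2 - 1 / (k : ℝ)) ≤ (T : ℝ) * (B : ℝ)) ∧
    -- round lower bound with bandwidth `O(log n)`
    (∀ β : ℝ, 0 < β → ∃ c : ℝ, 0 < c ∧ ∃ n₀ : ℕ, ∀ n ≥ n₀, ∀ B T : ℕ,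
      (B : ℝ) ≤ β * Real.log n →
      ∀ P : SimpleGraph (Fin n) → Prop,
        P = HasCopy (patternGraph k) n ∨ P = HasInducedCopy (patternGraph k) n →
        DeterministicallySolvable P B T ∨ RandomizedSolvable P B T →
        c * (n : ℝ) ^ (2 - 1 / (k : ℝ)) / Real.log n ≤ (T : ℝ)) :=
  mainTheorem2_general k (one_le_two.trans hk)
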